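/- A (fully connected) ReLU network with hidden widths $w_1,\dots,w_h$ is a map $T_{h+1}\circ\mathrm{ReLU}\circ T_h\circ\cdots\circ\mathrm{ReLU}\circ T_1$ with affine maps $T_i$, where $\mathrm{ReLU}(t)=\max(t,0)$ acts coordinatewise and $T_i$ ($i\le h$) takes values in $\mathbb{R}^{w_i}$; its number of parameters is the total number of its weights and biases. For $K\subset\mathbb{R}^n$ and $r>0$ let $N_r(K)$ be the smallest number of $\ell_\infty$-balls of radius $r$ needed to cover $K$. For $f:[0,1]^n\to\mathbb{R}$ let $$\omega(f,t)=\sup\{|f(x)-f(y)| : x,y\in[0,1]^n,\ \|x-y\|_\infty\le t\}\in[0,\infty],\qquad |f|_\alpha=\sup_{x\ne y}\frac{|f(x)-f(y)|}{\|x-y\|_2^\alpha}.$$ (1) There is an absolute constant $C\in\mathbb{N}$ such that the following holds for all integers $n,m\ge1$, every function $f:[0,1]^n\to\mathbb{R}$ and every $K\subset[0,1]^n$. There exist ReLU networks $\Phi:\mathbb{R}\to\mathbb{R}^{2n+1}$ and $\rho:\mathbb{R}^{(2n+1)\times n}\to\mathbb{R}$ such that $$|f(X)-\rho(\Phi(x_1),\dots,\Phi(x_n))|\le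 2\,\omega\!\left(f,\tfrac1{2m}\right)\qquad\text{for all }X=(x_1,\dots,x_n)\in K,$$ where $\Phi$ has three hidden layers of width $2(2n+1)(m+1)$, followed by one hidden layer of width $m+1$ and an output layer of width $2n+1$, and $\rho$ has $C(m+1)$ hidden layers of width $C(n+1)$, followed by $L$ hidden layers of width $12(2n+1)$ and an affine output layer, with $$L\le C\max\left\{\sqrt{N_r(K)\log[n(2m+1)N_r(K)]},\ (\log(2n+1))^2\right\},\qquad r=\frac1{2m(2n+1)}$$ (the square root is read as $0$ if $K=\emptyset$). (2) For every integer $n\ge1$ and all real $C_1$ and $d_{\mathrm{int}}\ge0$ there is a constant $C_2=C_2(C_1,n,d_{\mathrm{int}})$ such that, for every $K\subset[0,1]^n$ with $N_\delta(K)\le C_1\delta^{-d_{\mathrm{int}}}$ for all $0<\delta\le1$, every $\alpha\in(0,1]$, every $f:[0,1]^n\to\mathbb{R}$ with $|f|_\alpha\le1$ and every $\varepsilon\in(0,1]$, there is a ReLU network $\psi:\mathbb{R}^n\to\mathbb{R}$ with at most $C_2(1/\varepsilon)^{d_{\mathrm{int}}/(2\alpha)}$ parameters and $|f(X)-\psi(X)|\le\varepsilon$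 for all $X\in K$. -/

import Mathlib

open scoped ENNReal

noncomputable section

namespace IntrinsicReLU

/-- The rectified linear unit `max x 0`. -/
def relu (x : ℝ) : ℝ := max x 0

/-- An affine map `ℝ^a → ℝ^b`, given by its weights and biases. -/
structure AffineLayer (a b : ℕ) where
  weight : Matrix (Fin b) (Fin a) ℝ
  bias : Fin b → ℝ

/-- The map `x ↦ A x + β`. -/
def AffineLayer.eval {a b : ℕ} (T : AffineLayer a b) (x : Fin a → ℝ) : Fin b → ℝ :=
  fun i => (∑ j, T.weight i j * x j) + T.bias i

/-- A fully connected ReLU network with input dimension `a`, consecutive hidden layers whose widths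
are listed in `ws`, and output dimension `b`. -/
inductive ReLUNet : ℕ → List ℕ → ℕ → Type
  | output {a b : ℕ} (T : AffineLayer a b) : ReLUNet a [] b
  | hidden {a w : ℕ} {ws : List ℕ} {b : ℕ} (T : AffineLayer a w) (tail : ReLUNet w ws b) :
      ReLUNet a (w :: ws) b

/-- The function realized by a network: every hidden layer is an affine map followed by the
coordinatewise ReLU, and the output layer is affine. -/
def ReLUNet.eval {a : ℕ} {ws : List ℕ} {b : ℕ} : ReLUNet a ws b → (Fin a → ℝ) → Fin b → ℝ
  | .output T, x => T.eval x
  | .hidden T tail, x => tail.eval (fun i => relu (T.eval x i))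

/-- The total number of parameters (all weights and all biases, of the hidden layers and of the
output layer) of a network with input dimension `a`, hidden widths `ws`, output dimension `b`. -/
def numParams : ℕ → List ℕ → ℕ → ℕ
  | a, [], b => b * a + b
  | a, w :: ws, b => (w * a + w) + numParams w ws b

/-- The unit cube `[0,1]^n`. -/
def cube (n : ℕ) : Set (Fin n → ℝ) := Set.Icc 0 1

/-- The vector `(Φ(x₁), …, Φ(xₙ)) ∈ ℝ^(n N)`, for a network `Φ : ℝ → ℝ^N`. -/
def stack {n N : ℕ} {ws : List ℕ} (Φ : ReLUNet 1 ws N) (x : Fin n → ℝ) : Fin (n * N) → ℝ :=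
  fun p => Φ.eval (fun _ => x (finProdFinEquiv.symm p).1) (finProdFinEquiv.symm p).2

/-- The modulus of continuity on `[0,1]^n` with respect to the `ℓ_∞` distance (the distance that
`Fin n → ℝ` carries); its value is `∞` when the differences are unbounded. Only the values of `f`
on the cube matter. -/
def modulus {n : ℕ} (f : (Fin n → ℝ) → ℝ) (t : ℝ) : ℝ≥0∞ :=
  ⨆ x ∈ cube n, ⨆ y ∈ cube n, ⨆ _ : dist x y ≤ t, ENNReal.ofReal |f x - f y|

/-- The Euclidean norm on `Fin n → ℝ`. -/
def euclNorm {n : ℕ} (x : Fin n → ℝ) : ℝ := ‖WithLp.toLp 2 x‖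

/-- The `α`-Hölder seminorm on `[0,1]^n` with respect to the Euclidean norm, in `[0,∞]`. -/
def holderSeminorm {n : ℕ} (α : ℝ) (f : (Fin n → ℝ) → ℝ) : ℝ≥0∞ :=
  ⨆ x ∈ cube n, ⨆ y ∈ cube n, ⨆ _ : x ≠ y,
    ENNReal.ofReal (|f x - f y| / euclNorm (x - y) ^ α)

/-- `N_r(K)`: the smallest number of closed `ℓ_∞` balls of radius `r` (with arbitrary centres in
`ℝ^n`) that cover `K`. It is finite for the subsets of the cube, see `coveringNum_spec`. -/
def coveringNum {n : ℕ} (r : ℝ) (K : Set (Fin n → ℝ)) : ℕ :=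
  (Metric.externalCoveringNumber r.toNNReal K).toNat

theorem coveringNum_spec {n : ℕ} {r : ℝ} (hr : 0 < r) {K : Set (Fin n → ℝ)} (hK : K ⊆ cube n) :
    (coveringNum r K : ℕ∞) = Metric.externalCoveringNumber r.toNNReal K := by
  have hc : IsCompact (cube n) := isCompact_Icc
  obtain ⟨t, -, ht, hcov⟩ := hc.finite_cover_balls hr
  refine ENat.natCast_toNat (ne_top_of_le_ne_top (Set.encard_ne_top_iff.2 ht)
    (Metric.IsCover.externalCoveringNumber_le_encard (C := t) ?_))
  intro x hx
  obtain ⟨y, hy, hxy⟩ := Set.mem_iUnion₂.1 (hcov (hK hx))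
  refine ⟨y, hy, ?_⟩
  rw [Metric.mem_ball] at hxy
  show edist x y ≤ _
  rw [edist_dist]
  exact ENNReal.ofReal_le_ofReal hxy.le

end IntrinsicReLU

end

open IntrinsicReLU

/-!
# Approximation by ReLU networks on sets of small intrinsic dimension

The networks look up, in a table, the value of `f` on the grid cell that contains the point.

*Grids.* A network is continuous, so it cannot compute cell numbers near the walls of a grid.
Cover `K` by `N` cubes of side `g` and shift a grid of mesh `q g` by multiples of `g`, in `q`
ways. For each coordinate a cube is cut by at most one of these grids (`card_not_avoids_le`), and
on the cubes that a grid does not cut, steep ramps compute its cell numbers exactly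
(`Avoids.ramp_eq`). With `2 n + 1` grids fewer than half of them cut a given cube, so that the
median of the approximations found on the single grids is as good as an approximation on an uncut
one (`exists_nn_median`, `abs_sub_le_of_median`). If there are few cubes, a number of grids
logarithmic in `N` is enough, chosen by counting from `3 n + 1` shifts (`exists_shifts`).

*Memorization.* Integer keys `z` with integer values `v z` are stored as increments between
consecutive keys, in binary, on tapes: the digits of a real weight (`exists_nn_memorizing`). If
the increments have `T` digits in all, there are about `√T` tapes of `√T` symbols each. The
network first selects the tape that belongs to the query, then reads its symbols one by one; each
step is a few conditional assignments to six registers. Hence constant width and depth `O(√T)`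
suffice. The conditions are thresholds, which a ReLU network realizes on finite sets only, and the
set of keys is finite.

*Arbitrary functions.* The mesh is such that `f` oscillates on a cell by at most three times its
modulus `ω`, and labels in steps of `ω` cost an error `2 ω`. A functional with coefficients at
most `N²` is injective on the at most `N` cells that occur (`exists_weights_injOn`), so that keys
and labels have `O(log (n (2 m + 1) N))` digits, and `N` of them give the asserted depth
(`exists_channel`, `depth_le`). If at most `m + 1` grids are used, their cell numbers pass through
the narrow layer of width `m + 1`. Otherwise the coordinate itself passes, and the number `p` of
grids exceeds `m + 1`; computing the keys coordinate-wise then takes `p m ≤ p²` layers, which is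
of lower order, because `p = O(log N)` (`channels_sq_le`).

*Hölder functions.* Here `g` is of the order `ε^(1/α)` and the coordinates themselves are
available. The key of a cell interleaves the binary digits of its coordinates (`morton`), and the
digits are extracted one level after the other (`bitRun`). If `t` is the first level on which two
keys agree, their difference has at most `n t` digits and their values differ by `O(2^t)` quanta
`ε`, so that the cost of an increment is `O(n t + 1)`. Summing over the levels, the total cost is
a multiple of `∑ N_δ(K)` over `δ = g 2^s / 2` (`chainCost_le`, `exists_blocks`), a geometric
series dominated by its first term, of the order `ε^(-d/α)`. Its square root bounds the depth of a
network of fixed width, and also dominates the number `O(log (1/g))` of digit extractions. If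
`d = 0`, then `K` is a finite set of bounded cardinality, and `f` is interpolated
(`exists_nn_interpolating`).
-/

/-! ### Functions computed by ReLU networks -/

namespace IntrinsicReLU

/-- The function `f` is affine. This is a predicate on bare functions, so that `fun_prop` can
establish it. -/
@[fun_prop]
def IsAff {E F : Type} [AddCommGroup E] [Module ℝ E] [AddCommGroup F] [Module ℝ F]
    (f : E → F) : Prop :=
  ∃ T : E →ᵃ[ℝ] F, ∀ x, f x = T x

section IsAff

variable {E F G : Type} [AddCommGroup E] [Module ℝ E] [AddCommGroup F] [Module ℝ F]
  [AddCommGroup G] [Module ℝ G]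

@[fun_prop]
theorem IsAff.id' : IsAff (fun x : E => x) := ⟨AffineMap.id ℝ E, fun _ => rfl⟩

@[fun_prop]
theorem IsAff.const (c : F) : IsAff (fun _ : E => c) := ⟨AffineMap.const ℝ E c, fun _ => rfl⟩

@[fun_prop]
theorem IsAff.comp {g : F → G} {f : E → F} (hg : IsAff g) (hf : IsAff f) :
    IsAff (fun x => g (f x)) := by
  obtain ⟨T, hT⟩ := hg
  obtain ⟨U, hU⟩ := hf
  exact ⟨T.comp U, fun x => by simp [hT, hU]⟩

theorem IsAff.of_linear (T : E →ₗ[ℝ] F) : IsAff (fun x => T x) := ⟨T.toAffineMap, fun _ => rfl⟩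

@[fun_prop]
theorem IsAff.add {f g : E → F} (hf : IsAff f) (hg : IsAff g) : IsAff (fun x => f x + g x) := by
  obtain ⟨T, hT⟩ := hf
  obtain ⟨U, hU⟩ := hg
  exact ⟨T + U, fun x => by simp [hT, hU]⟩

@[fun_prop]
theorem IsAff.neg {f : E → F} (hf : IsAff f) : IsAff (fun x => -f x) := by
  obtain ⟨T, hT⟩ := hf
  exact ⟨-T, fun x => by simp [hT]⟩

@[fun_prop]
theorem IsAff.sub {f g : E → F} (hf : IsAff f) (hg : IsAff g) : IsAff (fun x => f x - g x) := by
  simpa [sub_eq_add_neg] using hf.add hg.neg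

@[fun_prop]
theorem IsAff.const_smul {f : E → F} (hf : IsAff f) (c : ℝ) : IsAff (fun x => c • f x) := by
  obtain ⟨T, hT⟩ := hf
  exact ⟨c • T, fun x => by simp [hT]⟩

@[fun_prop]
theorem IsAff.const_mul {f : E → ℝ} (hf : IsAff f) (c : ℝ) : IsAff (fun x => c * f x) :=
  hf.const_smul c

@[fun_prop]
theorem IsAff.mul_const {f : E → ℝ} (hf : IsAff f) (c : ℝ) : IsAff (fun x => f x * c) := by
  simpa [mul_comm] using hf.const_mul c

@[fun_prop]
theorem IsAff.div_const {f : E → ℝ} (hf : IsAff f) (c : ℝ) : IsAff (fun x => f x / c) := by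
  simpa [div_eq_mul_inv] using hf.mul_const c⁻¹

@[fun_prop]
theorem IsAff.sum {ι : Type*} (s : Finset ι) {f : ι → E → F} (hf : ∀ i, IsAff (f i)) :
    IsAff (fun x => ∑ i ∈ s, f i x) := by
  classical
  induction s using Finset.induction_on with
  | empty => simpa using IsAff.const (0 : F)
  | insert a s ha ih => simpa [Finset.sum_insert ha] using (hf a).add ih

@[fun_prop]
theorem IsAff.apply {ι : Type} (i : ι) : IsAff (fun x : ι → F => x i) :=
  IsAff.of_linear (LinearMap.proj (φ := fun _ : ι => F) i)

@[fun_prop]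
theorem IsAff.pi {ι : Type} {f : E → ι → F} (hf : ∀ i, IsAff (fun x => f x i)) : IsAff f := by
  choose T hT using hf
  exact ⟨AffineMap.pi T, fun x => by ext i; simp [hT]⟩

@[fun_prop]
theorem IsAff.fst {f : E → F × G} (hf : IsAff f) : IsAff (fun x => (f x).1) :=
  (IsAff.of_linear (LinearMap.fst ℝ F G)).comp hf

@[fun_prop]
theorem IsAff.snd {f : E → F × G} (hf : IsAff f) : IsAff (fun x => (f x).2) :=
  (IsAff.of_linear (LinearMap.snd ℝ F G)).comp hf

@[fun_prop]
theorem IsAff.prodMk {f : E → F} {g : E → G} (hf : IsAff f) (hg : IsAff g) :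
    IsAff (fun x => (f x, g x)) := by
  obtain ⟨T, hT⟩ := hf
  obtain ⟨U, hU⟩ := hg
  exact ⟨T.prod U, fun x => by simp [hT, hU]⟩

end IsAff

/-- The ReLU applied to every coordinate. -/
def reluMap {κ : Type} (x : κ → ℝ) : κ → ℝ := fun i => relu (x i)

/-- `NN ws f`: the function `f` is computed by a ReLU network with hidden widths `ws`. Its source
and target may be arbitrary real vector spaces, so that products and families of states need no
enumeration of their coordinates; see `NN.exists_reLUNet` for the return to `ReLUNet`. -/
def NN {F : Type} [AddCommGroup F] [Module ℝ F] :
    (ws : List ℕ) → {E : Type} → [AddCommGroup E] → [Module ℝ E] → (E → F) → Prop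
  | [], _, _, _, f => IsAff f
  | w :: ws, E, _, _, f => ∃ (T : E → Fin w → ℝ) (g : (Fin w → ℝ) → F),
      IsAff T ∧ NN ws g ∧ ∀ x, f x = g (reluMap (T x))

section NN

variable {E F G : Type} [AddCommGroup E] [Module ℝ E] [AddCommGroup F] [Module ℝ F]
  [AddCommGroup G] [Module ℝ G]

theorem NN.precomp {ws : List ℕ} {T : E → F} {g : F → G} (hg : NN ws g) (hT : IsAff T) :
    NN ws (fun x => g (T x)) := by
  cases ws with
  | nil => exact IsAff.comp hg hT
  | cons w ws =>
    obtain ⟨U, k, hU, hk, h⟩ := hg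
    exact ⟨fun x => U (T x), k, hU.comp hT, hk, fun x => h (T x)⟩

theorem NN.comp {ws ws' : List ℕ} {g : F → G} (hg : NN ws' g) {f : E → F} (hf : NN ws f) :
    NN (ws ++ ws') (fun x => g (f x)) := by
  induction ws generalizing E with
  | nil => exact hg.precomp hf
  | cons w ws ih =>
    obtain ⟨T, k, hT, hk, h⟩ := hf
    exact ⟨T, fun x => g (k x), hT, ih hk, fun x => congrArg g (h x)⟩

theorem NN.postcomp {ws : List ℕ} {f : E → F} (hf : NN ws f) {T : F → G} (hT : IsAff T) :
    NN ws (fun x => T (f x)) := by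
  simpa using NN.comp (ws' := []) hT hf

theorem NN.congr {ws : List ℕ} {f g : E → F} (hf : NN ws f) (h : ∀ x, g x = f x) : NN ws g := by
  rwa [show g = f from funext h]

/-- A hidden layer may be indexed by any finite type with at most `w` elements; the remaining
units get zero weights. -/
theorem NN.hidden {κ : Type} [Fintype κ] {w : ℕ} (hw : Fintype.card κ ≤ w) {ws : List ℕ}
    {T : E → κ → ℝ} (hT : IsAff T) {g : (κ → ℝ) → F} (hg : NN ws g) :
    NN (w :: ws) (fun x => g (reluMap (T x))) := by
  classical
  let e := Fintype.equivFin κ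
  refine ⟨fun x j => if h : (j : ℕ) < Fintype.card κ then T x (e.symm ⟨j, h⟩) else 0,
    fun y => g (fun i => y (Fin.castLE hw (e i))), ?_, hg.precomp (by fun_prop), fun x => ?_⟩
  · refine IsAff.pi fun j => ?_
    by_cases h : (j : ℕ) < Fintype.card κ
    · simp only [h, dif_pos]; fun_prop
    · simp only [h, dif_neg, not_false_iff]; fun_prop
  · refine congrArg g (funext fun i => ?_)
    simp [reluMap]

theorem NN.layer {κ : Type} [Fintype κ] {w : ℕ} (hw : Fintype.card κ ≤ w)
    {T : E → κ → ℝ} (hT : IsAff T) {A : (κ → ℝ) → F} (hA : IsAff A) :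
    NN [w] (fun x => A (reluMap (T x))) :=
  NN.hidden hw hT (ws := []) hA

theorem NN.mono {L w w' : ℕ} (hw : w ≤ w') {f : E → F} (hf : NN (List.replicate L w) f) :
    NN (List.replicate L w') f := by
  induction L generalizing E with
  | zero => exact hf
  | succ L ih =>
    obtain ⟨T, k, hT, hk, h⟩ := hf
    exact (NN.hidden (by simpa using hw) hT (ih hk)).congr h

theorem NN.comp_replicate {L L' w : ℕ} {g : F → G} (hg : NN (List.replicate L' w) g) {f : E → F}
    (hf : NN (List.replicate L w) f) : NN (List.replicate (L + L') w) (fun x => g (f x)) := by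
  rw [List.replicate_add]
  exact hg.comp hf

/-- Networks of the same shape run in parallel. -/
theorem NN.pi {p L w : ℕ} {f : Fin p → E → F} (hf : ∀ k, NN (List.replicate L w) (f k)) :
    NN (List.replicate L (p * w)) (fun (x : Fin p → E) k => f k (x k)) := by
  induction L generalizing E with
  | zero => exact IsAff.pi fun k => IsAff.comp (hf k) (IsAff.apply k)
  | succ L ih =>
    choose T g hT hg h using hf
    refine ((NN.hidden (κ := Fin p × Fin w) (by simp)
      (T := fun x kj => T kj.1 (x kj.1) kj.2) ?_
      ((ih hg).precomp (T := fun (y : Fin p × Fin w → ℝ) k j => y (k, j)) (by fun_prop)))).congr ?_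
    · exact IsAff.pi fun kj => (IsAff.apply kj.2).comp ((hT kj.1).comp (IsAff.apply kj.1))
    · intro x
      ext k
      exact h k (x k)

theorem relu_sub_relu_neg (x : ℝ) : relu x - relu (-x) = x := by
  unfold relu
  rcases le_total 0 x with h | h
  · rw [max_eq_left h, max_eq_right (by linarith)]; ring
  · rw [max_eq_right h, max_eq_left (by linarith)]; ring

/-- A layer with some ReLU units next to a copy of its input, two units for each coordinate. -/
theorem NN.layer_id {ι κ : Type} [Fintype ι] [Fintype κ] {w : ℕ}
    (hw : 2 * Fintype.card ι + Fintype.card κ ≤ w)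
    {T : (ι → ℝ) → κ → ℝ} (hT : IsAff T) {A : (ι → ℝ) × (κ → ℝ) → F} (hA : IsAff A) :
    NN [w] (fun x => A (x, reluMap (T x))) := by
  refine (NN.layer (κ := (ι ⊕ ι) ⊕ κ) (by simp; omega)
    (T := fun x => Sum.elim (Sum.elim x (fun i => -x i)) (T x))
    (A := fun y => A (fun i => y (.inl (.inl i)) - y (.inl (.inr i)), fun j => y (.inr j)))
    ?_ ?_).congr ?_
  · refine IsAff.pi fun i => ?_
    rcases i with (i | i) | i <;> simp <;> fun_prop
  · fun_prop
  · intro x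
    congr 2
    ext i
    simp [reluMap, relu_sub_relu_neg]

theorem NN.id {ι : Type} [Fintype ι] (L : ℕ) {w : ℕ} (hw : 2 * Fintype.card ι ≤ w) :
    NN (List.replicate L w) (fun x : ι → ℝ => x) := by
  induction L with
  | zero => exact IsAff.id'
  | succ L ih =>
    exact NN.comp (ws := [w]) ih (NN.layer_id (κ := Empty) (by simpa using hw)
      (T := fun _ => 0) (by fun_prop) (A := fun y => y.1) (by fun_prop))

theorem IsAff.exists_affineLayer {a b : ℕ} {f : (Fin a → ℝ) → Fin b → ℝ} (hf : IsAff f) :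
    ∃ T : AffineLayer a b, ∀ x, T.eval x = f x := by
  obtain ⟨T, hT⟩ := hf
  refine ⟨⟨LinearMap.toMatrix' T.linear, f 0⟩, fun x => ?_⟩
  have h1 : f x = T.linear x + f 0 := by
    simpa [hT] using congrFun T.decomp x
  ext i
  rw [h1]
  have := congrFun (LinearMap.toMatrix'_mulVec T.linear x) i
  simp only [AffineLayer.eval, Pi.add_apply, ← this]
  rfl

theorem NN.exists_reLUNet {a b : ℕ} {ws : List ℕ} {f : (Fin a → ℝ) → Fin b → ℝ} (hf : NN ws f) :
    ∃ net : ReLUNet a ws b, ∀ x, net.eval x = f x := by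
  induction ws generalizing a with
  | nil =>
    obtain ⟨T, hT⟩ := hf.exists_affineLayer
    exact ⟨.output T, hT⟩
  | cons w ws ih =>
    obtain ⟨T, g, hT, hg, h⟩ := hf
    obtain ⟨T', hT'⟩ := hT.exists_affineLayer
    obtain ⟨net, hnet⟩ := ih hg
    refine ⟨.hidden T' net, fun x => ?_⟩
    rw [h x, ← hnet, ReLUNet.eval, hT' x]
    rfl

end NN

/-- `FinNN ws f`: on every finite set the function `f` is computed by a network with hidden widths
`ws`. This allows discontinuous `f`. -/
def FinNN {E F : Type} [AddCommGroup E] [Module ℝ E] [AddCommGroup F] [Module ℝ F] (ws : List ℕ)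
    (f : E → F) : Prop :=
  ∀ S : Set E, S.Finite → ∃ g, NN ws g ∧ ∀ x ∈ S, g x = f x

section FinNN

variable {E F G : Type} [AddCommGroup E] [Module ℝ E] [AddCommGroup F] [Module ℝ F]
  [AddCommGroup G] [Module ℝ G]

theorem NN.finNN {ws : List ℕ} {f : E → F} (hf : NN ws f) : FinNN ws f :=
  fun _ _ => ⟨f, hf, fun _ _ => rfl⟩

theorem FinNN.comp {ws ws' : List ℕ} {g : F → G} (hg : FinNN ws' g) {f : E → F}
    (hf : FinNN ws f) : FinNN (ws ++ ws') (fun x => g (f x)) := by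
  intro S hS
  obtain ⟨f', hf', h1⟩ := hf S hS
  obtain ⟨g', hg', h2⟩ := hg (f '' S) (hS.image f)
  exact ⟨_, hg'.comp hf', fun x hx => by rw [h1 x hx, h2 _ ⟨x, hx, rfl⟩]⟩

theorem FinNN.comp_replicate {L L' w : ℕ} {g : F → G} (hg : FinNN (List.replicate L' w) g)
    {f : E → F} (hf : FinNN (List.replicate L w) f) :
    FinNN (List.replicate (L + L') w) (fun x => g (f x)) := by
  rw [List.replicate_add]
  exact hg.comp hf

theorem exists_forall_abs_le {E : Type} {S : Set E} (hS : S.Finite) {ι : Type} [Finite ι]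
    (f : E → ι → ℝ) : ∃ M : ℝ, 0 ≤ M ∧ ∀ x ∈ S, ∀ i, |f x i| ≤ M := by
  cases nonempty_fintype ι
  obtain ⟨M, hM⟩ := (hS.image f).isBounded.exists_norm_le
  exact ⟨max M 0, le_max_right _ _, fun x hx i =>
    ((norm_le_pi_norm (f x) i).trans (hM _ ⟨x, hx, rfl⟩)).trans (le_max_left _ _)⟩

/-- On a finite set the indicator function of `0 ≤ θ` is a difference of two ReLUs: the negative
values of `θ` are bounded away from `0`. -/
theorem exists_threshold {E : Type} {S : Set E} (hS : S.Finite) (θ : E → ℝ) :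
    ∃ c : ℝ, ∀ x ∈ S, relu (c * θ x + 1) - relu (c * θ x) = if 0 ≤ θ x then 1 else 0 := by
  obtain ⟨c, hc⟩ : ∃ c : ℝ, ∀ x ∈ S, |(θ x)⁻¹| ≤ c :=
    (hS.image fun x => |(θ x)⁻¹|).bddAbove.imp fun c hc x hx => hc ⟨x, hx, rfl⟩
  refine ⟨max c 0, fun x hx => ?_⟩
  have hc0 := le_max_right c 0
  have h1 : |(θ x)⁻¹| ≤ max c 0 := (hc x hx).trans (le_max_left _ _)
  split_ifs with h
  · have : 0 ≤ max c 0 * θ x := mul_nonneg hc0 h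
    rw [relu, relu, max_eq_left this, max_eq_left (by linarith)]; ring
  · push Not at h
    have h2 : max c 0 * θ x ≤ -1 := by
      rw [abs_inv, abs_of_neg h] at h1
      have := mul_le_mul_of_nonneg_right h1 (by linarith : 0 ≤ -θ x)
      rw [inv_mul_cancel₀ (by linarith)] at this
      linarith
    rw [relu, relu, max_eq_right (by linarith), max_eq_right (by linarith)]; ring

theorem relu_gate_add_relu_gate {M y z : ℝ} (hy : |y| ≤ M) (hz : |z| ≤ M) (P : Prop)
    [Decidable P] :
    relu (y + M * (2 * (if P then 1 else 0) - 1)) + relu (z + M * (1 - 2 * (if P then 1 else 0))) -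
      M = if P then y else z := by
  have := abs_le.1 hy
  have := abs_le.1 hz
  unfold relu
  split_ifs
  · rw [max_eq_left (by linarith), max_eq_right (by linarith)]; ring
  · rw [max_eq_right (by linarith), max_eq_left (by linarith)]; ring

/-- A branching instruction on six registers takes two layers of width twelve: the first computes
the truth value of the condition, the second lets exactly one of the two results pass. -/
theorem FinNN.ite {θ : (Fin 6 → ℝ) → ℝ} (hθ : IsAff θ) {A B : (Fin 6 → ℝ) → Fin 6 → ℝ}
    (hA : IsAff A) (hB : IsAff B) :
    FinNN (List.replicate 2 12) (fun x => if 0 ≤ θ x then A x else B x) := by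
  intro S hS
  obtain ⟨c, hc⟩ := exists_threshold hS θ
  obtain ⟨M₀, hM₀, h0⟩ := exists_forall_abs_le hS (fun x => x)
  obtain ⟨M₁, -, h1⟩ := exists_forall_abs_le hS A
  obtain ⟨M₂, -, h2⟩ := exists_forall_abs_le hS B
  set M := max M₁ M₂
  let T₁ : (Fin 6 → ℝ) → Fin 6 ⊕ Fin 2 → ℝ := fun x =>
    Sum.elim (fun i => x i + M₀) ![c * θ x + 1, c * θ x]
  let A₁ : (Fin 6 ⊕ Fin 2 → ℝ) → (Fin 6 → ℝ) × ℝ := fun y =>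
    (fun i => y (.inl i) - M₀, y (.inr 0) - y (.inr 1))
  let T₂ : (Fin 6 → ℝ) × ℝ → Fin 6 ⊕ Fin 6 → ℝ := fun z =>
    Sum.elim (fun i => A z.1 i + M * (2 * z.2 - 1)) (fun i => B z.1 i + M * (1 - 2 * z.2))
  let A₂ : (Fin 6 ⊕ Fin 6 → ℝ) → Fin 6 → ℝ := fun y i => y (.inl i) + y (.inr i) - M
  have hT₁ : IsAff T₁ := by
    refine IsAff.pi fun i => ?_
    rcases i with i | i
    · simp only [T₁, Sum.elim_inl]; fun_prop
    · fin_cases i <;> simp [T₁] <;> fun_prop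
  have hT₂ : IsAff T₂ := by
    refine IsAff.pi fun i => ?_
    rcases i with i | i <;> simp only [T₂, Sum.elim_inl, Sum.elim_inr] <;> fun_prop
  have l₁ : NN [12] (fun x => A₁ (reluMap (T₁ x))) :=
    NN.layer (by simp) hT₁ (by fun_prop)
  have l₂ : NN [12] (fun x => A₂ (reluMap (T₂ x))) :=
    NN.layer (by simp) hT₂ (by fun_prop)
  refine ⟨_, l₂.comp l₁, fun x hx => ?_⟩
  have e₁ : A₁ (reluMap (T₁ x)) = (x, if 0 ≤ θ x then 1 else 0) := by
    refine Prod.ext (funext fun i => ?_) (hc x hx)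
    have : 0 ≤ x i + M₀ := by linarith [(abs_le.1 (h0 x hx i)).1]
    simp [A₁, T₁, reluMap, relu, this]
  simp only [e₁]
  ext i
  refine (relu_gate_add_relu_gate ((h1 x hx i).trans (le_max_left _ _))
    ((h2 x hx i).trans (le_max_right _ _)) (0 ≤ θ x)).trans ?_
  split_ifs <;> rfl

end FinNN

end IntrinsicReLU

/-! ### Memorization by reading a tape -/

namespace IntrinsicReLU

namespace Tape

/-- The registers of the tape machine are, in this order, the distance `r` from the current key to
the query, the current value `w`, the partially read key increment `a`, the partially read value
increment `b`, the unread tape `τ` and the output `o`. -/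
abbrev State : Type := Fin 6 → ℝ

/-- Read one binary digit of the key increment. -/
noncomputable def readKey (H : ℕ) (s : State) : State :=
  if 0 ≤ s 4 - 4 * 8 ^ H then ![s 0, s 1, 2 * s 2 + 1, s 3, s 4 - 4 * 8 ^ H, s 5]
  else ![s 0, s 1, 2 * s 2, s 3, s 4, s 5]

/-- Read one binary digit of the value increment. -/
noncomputable def readVal (H : ℕ) (s : State) : State :=
  if 0 ≤ s 4 - 2 * 8 ^ H then ![s 0, s 1, s 2, 2 * s 3 + 1, s 4 - 2 * 8 ^ H, s 5]
  else ![s 0, s 1, s 2, 2 * s 3, s 4, s 5]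

/-- If the end marker is read, move to the next key. The register `b` is reset to `-1/2`, so that
`T` digits read into it give a number between `-2 ^ (T - 1)` and `2 ^ (T - 1) - 1`. -/
noncomputable def commit (H : ℕ) (s : State) : State :=
  if 0 ≤ s 4 - 8 ^ H then ![s 0 - s 2, s 1 + s 3, 0, -(1 / 2), s 4 - 8 ^ H, s 5]
  else s

/-- As long as the current key does not exceed the query, its value is the output. Keys increase
along the tape, so that the output stays fixed once the query is passed. -/
noncomputable def latch (s : State) : State :=
  if 0 ≤ s 0 then ![s 0, s 1, s 2, s 3, s 4, s 1] else s

/-- Process one symbol of the tape. -/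
noncomputable def symStep (H : ℕ) (s : State) : State := latch (commit H (readVal H (readKey H s)))

/-- Process a tape of `H` symbols. -/
noncomputable def run : ℕ → State → State
  | 0, s => s
  | H + 1, s => run H (symStep H s)

/-- The six hypotheses, one for each register, can be left to `fun_prop`. -/
theorem isAff_vec6 {E : Type} [AddCommGroup E] [Module ℝ E] {f₀ f₁ f₂ f₃ f₄ f₅ : E → ℝ}
    (h₀ : IsAff f₀) (h₁ : IsAff f₁) (h₂ : IsAff f₂) (h₃ : IsAff f₃) (h₄ : IsAff f₄)
    (h₅ : IsAff f₅) : IsAff (fun x => ![f₀ x, f₁ x, f₂ x, f₃ x, f₄ x, f₅ x]) := by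
  refine IsAff.pi fun i => ?_
  fin_cases i <;> assumption

theorem finNN_symStep (H : ℕ) : FinNN (List.replicate 8 12) (symStep H) := by
  have h₁ : FinNN (List.replicate 2 12) (readKey H) :=
    FinNN.ite (by fun_prop) (by apply isAff_vec6 <;> fun_prop) (by apply isAff_vec6 <;> fun_prop)
  have h₂ : FinNN (List.replicate 2 12) (readVal H) :=
    FinNN.ite (by fun_prop) (by apply isAff_vec6 <;> fun_prop) (by apply isAff_vec6 <;> fun_prop)
  have h₃ : FinNN (List.replicate 2 12) (commit H) :=
    FinNN.ite (by fun_prop) (by apply isAff_vec6 <;> fun_prop) (by fun_prop)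
  have h₄ : FinNN (List.replicate 2 12) latch :=
    FinNN.ite (by fun_prop) (by apply isAff_vec6 <;> fun_prop) (by fun_prop)
  exact h₄.comp_replicate (h₃.comp_replicate (h₂.comp_replicate h₁))

theorem finNN_run (H : ℕ) : FinNN (List.replicate (8 * H) 12) (run H) := by
  induction H with
  | zero => exact NN.finNN (IsAff.id' : NN [] _)
  | succ H ih =>
    rw [show 8 * (H + 1) = 8 + 8 * H by ring]
    exact ih.comp_replicate (finNN_symStep H)

/-- A tape symbol: a digit of a key increment, a digit of a value increment, and a marker for the
end of an item. -/
abbrev Symb : Type := Bool × Bool × Bool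

/-- A tape as a number in base eight; the next symbol is the leading digit, so that it can be read
by comparing the number with multiples of a power of `8`. -/
def enc : List Symb → ℕ
  | [] => 0
  | (κ, ν, e) :: l => (4 * κ.toNat + 2 * ν.toNat + e.toNat) * 8 ^ l.length + enc l

theorem enc_lt (l : List Symb) : enc l < 8 ^ l.length := by
  induction l with
  | nil => simp [enc]
  | cons x l ih =>
    obtain ⟨κ, ν, e⟩ := x
    have : 4 * κ.toNat + 2 * ν.toNat + e.toNat ≤ 7 := by
      have := κ.toNat_le; have := ν.toNat_le; have := e.toNat_le; omega
    simp only [enc, List.length_cons, pow_succ]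
    nlinarith

theorem symStep_enc (r w a b o : ℝ) (κ ν e : Bool) (l : List Symb) :
    symStep l.length ![r, w, a, b, (enc ((κ, ν, e) :: l) : ℕ), o] =
      if e then ![r - (2 * a + κ.toNat), w + (2 * b + ν.toNat), 0, -(1 / 2), (enc l : ℕ),
        if 0 ≤ r - (2 * a + κ.toNat) then w + (2 * b + ν.toNat) else o]
      else ![r, w, 2 * a + κ.toNat, 2 * b + ν.toNat, (enc l : ℕ), if 0 ≤ r then w else o] := by
  have h1 : (enc l : ℝ) < 8 ^ l.length := by exact_mod_cast enc_lt l
  have h0 : (0 : ℝ) ≤ enc l := Nat.cast_nonneg _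
  have e1 : readKey l.length ![r, w, a, b, (enc ((κ, ν, e) :: l) : ℕ), o] =
      ![r, w, 2 * a + κ.toNat, b, (2 * ν.toNat + e.toNat) * 8 ^ l.length + enc l, o] := by
    cases κ <;> cases ν <;> cases e <;> simp [readKey, enc] <;>
      first
      | linarith
      | (rw [if_neg (by linarith)]; norm_num)
      | (rw [if_pos (by linarith)]; congr; ring)
  have e2 : readVal l.length
      ![r, w, 2 * a + κ.toNat, b, (2 * ν.toNat + e.toNat) * 8 ^ l.length + enc l, o] =
      ![r, w, 2 * a + κ.toNat, 2 * b + ν.toNat, e.toNat * 8 ^ l.length + enc l, o] := by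
    cases ν <;> cases e <;> simp [readVal] <;>
      first
      | linarith
      | (rw [if_pos (by linarith)]; congr; ring)
  rw [symStep, e1, e2]
  cases e
  · by_cases h : 0 ≤ r <;> simp [commit, latch, not_le.2 h1, h]
  · by_cases h : 2 * a + κ.toNat ≤ r <;> simp [commit, latch, h]

/-- An item of the tape: the increment of the key, the increment of the value, and the number of
symbols used for it, less one. -/
abbrev Item : Type := ℕ × ℤ × ℕ

/-- The symbols that spell the lowest `T` binary digits of `γ` and `D`, the leading digit first. -/
def code (γ D : ℕ) : ℕ → List Symb
  | 0 => []
  | T + 1 => (γ.testBit T, D.testBit T, decide (T = 0)) :: code γ D T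

theorem length_code (γ D T : ℕ) : (code γ D T).length = T := by
  induction T with
  | zero => rfl
  | succ T ih => simp [code, ih]

theorem run_code (γ D T : ℕ) (l : List Symb) (r w a b o : ℝ) (ho : 0 ≤ r → o = w) :
    run (code γ D (T + 1) ++ l).length ![r, w, a, b, (enc (code γ D (T + 1) ++ l) : ℕ), o] =
      run l.length ![r - (2 ^ (T + 1) * a + (γ % 2 ^ (T + 1) : ℕ)),
        w + (2 ^ (T + 1) * b + (D % 2 ^ (T + 1) : ℕ)), 0, -(1 / 2), (enc l : ℕ),
        if 0 ≤ r - (2 ^ (T + 1) * a + (γ % 2 ^ (T + 1) : ℕ)) then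
          w + (2 ^ (T + 1) * b + (D % 2 ^ (T + 1) : ℕ)) else o] := by
  induction T generalizing a b with
  | zero =>
    simp only [code, List.cons_append, List.nil_append, List.length_cons, run, symStep_enc]
    simp [Nat.toNat_testBit, -Nat.testBit_zero]
  | succ T ih =>
    rw [code, List.cons_append, List.length_cons, run, symStep_enc]
    have : (if 0 ≤ r then w else o) = o := by
      split_ifs with h
      · exact (ho h).symm
      · rfl
    simp only [Nat.add_eq_zero_iff, one_ne_zero, and_false, decide_false, Bool.false_eq_true,
      if_false, this]
    rw [ih]
    have e1 : ∀ (x : ℝ) (g : ℕ), 2 ^ (T + 1) * (2 * x + (g.testBit (T + 1)).toNat) +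
        (g % 2 ^ (T + 1) : ℕ) = 2 ^ (T + 1 + 1) * x + (g % 2 ^ (T + 1 + 1) : ℕ) := by
      intro x g
      rw [Nat.mod_pow_succ (k := T + 1), Nat.toNat_testBit]
      push_cast
      ring
    simp only [e1]

/-- The blank symbol leaves the output unchanged. -/
theorem run_blank (d : ℕ) (r w a b o : ℝ) (ho : 0 ≤ r → o = w) :
    run (List.replicate d ((false, false, false) : Symb)).length
      ![r, w, a, b, (enc (List.replicate d (false, false, false)) : ℕ), o] 5 = o := by
  induction d generalizing a b with
  | zero => simp [run]
  | succ d ih =>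
    rw [List.replicate_succ, List.length_cons, run, symStep_enc]
    have : (if 0 ≤ r then w else o) = o := by
      split_ifs with h
      · exact (ho h).symm
      · rfl
    simp only [Bool.false_eq_true, if_false, this]
    exact ih _ _

/-- The number of symbols that spell the items. -/
def itemsCost (l : List Item) : ℕ := (l.map fun i => i.2.2 + 1).sum

/-- The symbols that spell a list of items. -/
def codes : List Item → List Symb
  | [] => []
  | (γ, Δ, T) :: l => code γ (Δ + 2 ^ T).toNat (T + 1) ++ codes l

theorem length_codes (l : List Item) : (codes l).length = itemsCost l := by
  induction l with
  | nil => rfl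
  | cons x l ih => simp [codes, length_code, ih, itemsCost]

/-- The increments of an item fit into its symbols. -/
def ItemFits (i : Item) : Prop :=
  0 < i.1 ∧ i.1 < 2 ^ (i.2.2 + 1) ∧ -2 ^ i.2.2 ≤ i.2.1 ∧ i.2.1 < 2 ^ i.2.2

/-- The value stored for the largest key not exceeding the query, if `r ≥ 0` is the distance from
the first key to the query and `w` is the value of the first key. -/
def look (r w : ℤ) : List Item → ℤ
  | [] => w
  | (γ, Δ, _) :: l => if (γ : ℤ) ≤ r then look (r - γ) (w + Δ) l else w

theorem run_codes (l : List Item) (hl : ∀ i ∈ l, ItemFits i) (d : ℕ) (r w : ℤ) (o : ℝ)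
    (ho : 0 ≤ r → o = w) :
    run (codes l ++ List.replicate d (false, false, false)).length
      ![r, w, 0, -(1 / 2), (enc (codes l ++ List.replicate d (false, false, false)) : ℕ), o] 5 =
        if 0 ≤ r then (look r w l : ℝ) else o := by
  induction l generalizing r w o with
  | nil =>
    rw [codes, List.nil_append, run_blank d _ _ _ _ _ (by exact_mod_cast ho)]
    split_ifs with h
    · exact ho h
    · rfl
  | cons x l ih =>
    obtain ⟨γ, Δ, T⟩ := x
    obtain ⟨h1, h2, h3, h4⟩ := hl _ List.mem_cons_self
    simp only at h1 h2 h3 h4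
    rw [codes, List.append_assoc, run_code _ _ _ _ _ _ _ _ _ (by exact_mod_cast ho)]
    have e1 : γ % 2 ^ (T + 1) = γ := Nat.mod_eq_of_lt h2
    have e2 : (Δ + 2 ^ T).toNat % 2 ^ (T + 1) = (Δ + 2 ^ T).toNat := by
      refine Nat.mod_eq_of_lt ?_
      zify
      rw [Int.toNat_of_nonneg (by linarith), pow_succ]
      linarith
    have e3 : (((Δ + 2 ^ T).toNat : ℕ) : ℝ) = Δ + 2 ^ T := by
      have : (((Δ + 2 ^ T).toNat : ℕ) : ℤ) = Δ + 2 ^ T := Int.toNat_of_nonneg (by linarith)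
      exact_mod_cast this
    rw [e1, e2, e3]
    have e4 : (r : ℝ) - (2 ^ (T + 1) * 0 + γ) = ((r - γ : ℤ) : ℝ) := by push_cast; ring
    have e5 : (w : ℝ) + (2 ^ (T + 1) * -(1 / 2) + (Δ + 2 ^ T)) = ((w + Δ : ℤ) : ℝ) := by
      push_cast; ring
    rw [e4, e5, ih (fun i hi => hl i (List.mem_cons_of_mem _ hi))]
    · simp only [look, Int.cast_nonneg_iff, sub_nonneg]
      by_cases h : (γ : ℤ) ≤ r
      · have : 0 ≤ r := by omega
        simp [h, this]
      · by_cases h' : 0 ≤ r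
        · simp [h, h', ho h']
        · simp [h, h']
    · intro h
      rw [if_pos (by exact_mod_cast h)]

/-- A group of consecutive keys: the first key, its value, and the items for the others. -/
abbrev Group : Type := ℤ × ℤ × List Item

/-- The last group of the list `g :: gs` whose first key does not exceed `y`, if the first keys are
increasing and that of `g` does not exceed `y`. -/
def pick (y : ℤ) (g : Group) : List Group → Group
  | [] => g
  | h :: gs => if h.1 ≤ y then pick y h gs else pick y g gs

theorem pick_eq_self {y : ℤ} {g : Group} {gs : List Group} (h : ∀ k ∈ gs, y < k.1) :
    pick y g gs = g := by
  induction gs with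
  | nil => rfl
  | cons k gs ih =>
    rw [pick, if_neg (not_le.2 (h k List.mem_cons_self)),
      ih fun k hk => h k (List.mem_cons_of_mem _ hk)]

theorem pick_cases (y : ℤ) (g g' : Group) (gs : List Group) :
    (pick y g gs = g ∧ pick y g' gs = g') ∨ pick y g' gs = pick y g gs := by
  induction gs with
  | nil => exact .inl ⟨rfl, rfl⟩
  | cons k gs ih =>
    by_cases h : k.1 ≤ y
    · right; simp [pick, h]
    · simpa [pick, h] using ih

theorem pick_mem (y : ℤ) (g : Group) (gs : List Group) : pick y g gs ∈ g :: gs := by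
  induction gs generalizing g with
  | nil => simp [pick]
  | cons k gs ih =>
    rw [pick]
    split_ifs
    · exact List.mem_cons_of_mem _ (ih k)
    · have := ih g
      simp only [List.mem_cons] at this ⊢
      tauto

/-- The sum of the costs of the consecutive pairs of a list. -/
def chainCost (c : ℤ → ℤ → ℕ) : List ℤ → ℕ
  | [] => 0
  | [_] => 0
  | a :: b :: l => c a b + chainCost c (b :: l)

/-- The pair of increments between consecutive keys `z` and `z'` fits into `c z z' + 1` symbols. -/
def PairFits (v : ℤ → ℤ) (c : ℤ → ℤ → ℕ) (z z' : ℤ) : Prop :=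
  z < z' ∧ z' - z < 2 ^ (c z z' + 1) ∧ -2 ^ c z z' ≤ v z' - v z ∧ v z' - v z < 2 ^ c z z'

/-- Greedy grouping, beginning with the last key: two neighbouring groups together cost more than
`S`, which bounds the number of groups. -/
theorem exists_groups (S : ℕ) (v : ℤ → ℤ) (c : ℤ → ℤ → ℕ) (z : ℤ) (l : List ℤ)
    (hl : (z :: l).IsChain (PairFits v c)) :
    ∃ (its : List Item) (gs : List Group),
      (∀ h ∈ (z, v z, its) :: gs, itemsCost h.2.2 ≤ S ∧ ∀ i ∈ h.2.2, ItemFits i) ∧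
      S * gs.length + itemsCost its ≤ 2 * chainCost (fun z z' => c z z' + 1) (z :: l) ∧
      (∀ h ∈ gs, z < h.1) ∧ (∀ y ∈ z :: l, z ≤ y) ∧
      ∀ y ∈ z :: l, (pick y (z, v z, its) gs).1 ≤ y ∧
        look (y - (pick y (z, v z, its) gs).1) (pick y (z, v z, its) gs).2.1
          (pick y (z, v z, its) gs).2.2 = v y := by
  induction l generalizing z with
  | nil => exact ⟨[], [], by simp [itemsCost, chainCost, pick, look]⟩
  | cons z₁ l ih =>
    rw [List.isChain_cons_cons] at hl
    obtain ⟨⟨f1, f2, f3, f4⟩, hl⟩ := hl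
    obtain ⟨its, gs, h1, h2, h3, h4, h5⟩ := ih z₁ hl
    have h6 : ∀ y ∈ z :: z₁ :: l, z ≤ y := by
      intro y hy
      rcases List.mem_cons.1 hy with rfl | hy
      · exact le_rfl
      · exact f1.le.trans (h4 y hy)
    by_cases hS : itemsCost its + (c z z₁ + 1) ≤ S
    · -- the key `z` joins the head group
      let it : Item := ((z₁ - z).toNat, v z₁ - v z, c z z₁)
      have hit : ((it.1 : ℕ) : ℤ) = z₁ - z := Int.toNat_of_nonneg (by linarith)
      refine ⟨it :: its, gs, ?_, ?_, fun h hh => f1.trans (h3 h hh), h6, ?_⟩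
      · intro h hh
        rcases List.mem_cons.1 hh with rfl | hh
        · refine ⟨by simp only [itemsCost, List.map_cons, List.sum_cons, it] at hS ⊢; omega, ?_⟩
          intro i hi
          rcases List.mem_cons.1 hi with rfl | hi
          · refine ⟨by zify; rw [hit]; linarith, by zify; rw [hit]; exact f2, f3, f4⟩
          · exact (h1 _ List.mem_cons_self).2 i hi
        · exact h1 h (List.mem_cons_of_mem _ hh)
      · simp only [itemsCost, List.map_cons, List.sum_cons, chainCost, it] at h2 ⊢
        omega
      · intro y hy
        rcases List.mem_cons.1 hy with rfl | hy
        · rw [pick_eq_self fun k hk => f1.trans (h3 k hk)]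
          refine ⟨le_rfl, ?_⟩
          simp only [look]
          rw [if_neg (by rw [hit]; linarith)]
        · rcases pick_cases y (z₁, v z₁, its) (z, v z, it :: its) gs with ⟨e1, e2⟩ | e
          · have h7 := h5 y hy
            rw [e1] at h7
            rw [e2]
            refine ⟨f1.le.trans h7.1, ?_⟩
            simp only [look, it]
            rw [if_pos (by rw [hit]; linarith [h7.1]), hit, ← h7.2]
            congr 1 <;> ring
          · rw [e]; exact h5 y hy
    · -- the key `z` begins a new group in front of the former head group
      refine ⟨[], (z₁, v z₁, its) :: gs, ?_, ?_, ?_, h6, ?_⟩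
      · intro h hh
        rcases List.mem_cons.1 hh with rfl | hh
        · simp [itemsCost]
        · exact h1 h hh
      · simp only [itemsCost, chainCost, List.length_cons, List.map_nil, List.sum_nil,
          mul_add] at h2 hS ⊢
        omega
      · intro h hh
        rcases List.mem_cons.1 hh with rfl | hh
        · exact f1
        · exact f1.trans (h3 h hh)
      · intro y hy
        rcases List.mem_cons.1 hy with rfl | hy
        · rw [pick_eq_self]
          · simp [look]
          · intro k hk
            rcases List.mem_cons.1 hk with rfl | hk
            · exact f1
            · exact f1.trans (h3 k hk)
        · rw [pick, if_pos (h4 y hy)]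
          exact h5 y hy

/-- The tape of a group, filled up with blanks to `S` symbols. -/
def tape (S : ℕ) (g : Group) : List Symb :=
  codes g.2.2 ++ List.replicate (S - itemsCost g.2.2) (false, false, false)

/-- The registers after a group is loaded; the register `a` temporarily holds the first key. -/
def loaded (S : ℕ) (q : ℝ) (g : Group) : State := ![q, g.2.1, g.1, 0, (enc (tape S g) : ℕ), 0]

/-- Load the group if its first key does not exceed the query. -/
noncomputable def load (S : ℕ) (g : Group) (s : State) : State :=
  if 0 ≤ s 0 - g.1 then loaded S (s 0) g else s

/-- Load successively all groups whose first key does not exceed the query. -/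
noncomputable def loadAll (S : ℕ) : List Group → State → State
  | [], s => s
  | g :: gs, s => loadAll S gs (load S g s)

theorem loadAll_loaded (S : ℕ) (y : ℤ) (g : Group) (gs : List Group) :
    loadAll S gs (loaded S y g) = loaded S y (pick y g gs) := by
  induction gs generalizing g with
  | nil => rfl
  | cons k gs ih =>
    rw [loadAll, load, pick]
    have : (0 ≤ loaded S y g 0 - k.1) ↔ k.1 ≤ y := by
      simp [loaded, sub_nonneg]
    simp only [this]
    split_ifs
    · exact ih k
    · exact ih g

theorem finNN_loadAll (S : ℕ) {M : ℕ} (gs : List Group) (hM : gs.length ≤ M) :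
    FinNN (List.replicate (2 * M) 12) (loadAll S gs) := by
  induction gs generalizing M with
  | nil =>
    clear hM
    induction M with
    | zero => exact NN.finNN (IsAff.id' : NN [] _)
    | succ M ih =>
      rw [show 2 * (M + 1) = 2 + 2 * M by ring]
      have h : FinNN (List.replicate 2 12) (fun s : State => if 0 ≤ s 0 then s else s) :=
        FinNN.ite (by fun_prop) (by fun_prop) (by fun_prop)
      simp only [ite_self] at h
      exact ih.comp_replicate h
  | cons g gs ih =>
    obtain ⟨M, rfl⟩ : ∃ N, M = N + 1 := ⟨M - 1, by simp at hM; omega⟩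
    rw [show 2 * (M + 1) = 2 + 2 * M by ring]
    have h : FinNN (List.replicate 2 12) (load S g) :=
      FinNN.ite (by fun_prop) (by apply isAff_vec6 <;> fun_prop) (by fun_prop)
    exact (ih (by simpa using hM)).comp_replicate h

end Tape

open Tape in
/-- Keys `z` in increasing order with values `v z`, whose increments can be spelled with `S²` binary
digits in all, are memorized by a network of width `12` and depth `12 S`: the keys are grouped, the
tape of the right group is loaded, and the tape is read. -/
theorem exists_nn_memorizing {S : ℕ} (hS : 0 < S) (v : ℤ → ℤ) (c : ℤ → ℤ → ℕ) (l : List ℤ)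
    (hl : l.IsChain (PairFits v c)) (hc : chainCost (fun z z' => c z z' + 1) l ≤ S * S) :
    ∃ g : ℝ → ℝ, NN (List.replicate (12 * S) 12) g ∧ ∀ z ∈ l, g z = v z := by
  cases l with
  | nil =>
    refine ⟨fun _ => 0, ?_, by simp⟩
    have h := (NN.id (ι := Fin 1) (12 * S) (w := 12) (by simp)).postcomp
      (T := fun _ => (0 : ℝ)) (by fun_prop)
    exact h.precomp (T := fun _ : ℝ => (0 : Fin 1 → ℝ)) (by fun_prop)
  | cons z l =>
    obtain ⟨its, gs, h1, h2, -, -, h5⟩ := exists_groups S v c z l hl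
    have hlen : gs.length ≤ 2 * S := by
      refine Nat.le_of_mul_le_mul_left (?_ : S * gs.length ≤ S * (2 * S)) hS
      calc S * gs.length ≤ 2 * (S * S) := by omega
        _ = S * (2 * S) := by ring
    let start : State → State := fun s => ![s 0 - s 2, s 1, 0, -(1 / 2), s 4, s 1]
    have hstart : IsAff start := by apply isAff_vec6 <;> fun_prop
    have hinit : IsAff fun q : ℝ => loaded S q (z, v z, its) :=
      isAff_vec6 IsAff.id' (IsAff.const _) (IsAff.const _) (IsAff.const _) (IsAff.const _)
        (IsAff.const _)
    have hF : FinNN (List.replicate (2 * (2 * S) + 8 * S) 12) fun q : ℝ =>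
        run S (start (loadAll S gs (loaded S q (z, v z, its)))) := by
      have k1 : FinNN (List.replicate (2 * (2 * S)) 12) fun q : ℝ =>
          loadAll S gs (loaded S q (z, v z, its)) :=
        (finNN_loadAll S gs hlen).comp (NN.finNN (ws := []) hinit)
      have k2 : FinNN (List.replicate (8 * S) 12) fun s => run S (start s) :=
        (finNN_run S).comp (NN.finNN (ws := []) hstart)
      exact k2.comp_replicate k1
    obtain ⟨g, hg, hgv⟩ := hF ((fun y : ℤ => (y : ℝ)) '' {y | y ∈ z :: l})
      ((List.finite_toSet (z :: l)).image _)
    rw [show 2 * (2 * S) + 8 * S = 12 * S by ring] at hg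
    refine ⟨fun q => g q 5, hg.postcomp (T := fun s : State => s 5) (by fun_prop), fun y hy => ?_⟩
    simp only [hgv _ ⟨y, hy, rfl⟩, loadAll_loaded]
    obtain ⟨h6, h7⟩ := h5 y hy
    set h := pick y (z, v z, its) gs
    obtain ⟨h8, h9⟩ := h1 h (pick_mem _ _ _)
    have hlenS : (tape S h).length = S := by
      simp [tape, length_codes]; omega
    have e : start (loaded S y h) =
        ![((y - h.1 : ℤ) : ℝ), h.2.1, 0, -(1 / 2), (enc (tape S h) : ℕ), h.2.1] := by
      simp [start, loaded]
    have key := run_codes h.2.2 h9 (S - itemsCost h.2.2) (y - h.1) h.2.1 h.2.1 (fun _ => rfl)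
    rw [if_pos (by linarith), h7] at key
    rw [e, ← key]
    change run S _ 5 = run (tape S h).length _ 5
    rw [hlenS]
    rfl

end IntrinsicReLU

/-! ### Medians -/

namespace IntrinsicReLU

/-- Exchange the entries `i` and `j` if they are in the wrong order. -/
noncomputable def compareExchange {p : ℕ} (i j : Fin p) (x : Fin p → ℝ) : Fin p → ℝ :=
  if x i ≤ x j then x else x ∘ Equiv.swap i j

theorem nn_compareExchange {p w : ℕ} (hw : 2 * p + 1 ≤ w) {i j : Fin p} (hij : i ≠ j) :
    NN [w] (compareExchange i j) := by
  refine (NN.layer_id (ι := Fin p) (κ := Unit) (by simpa using hw)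
    (T := fun x _ => x i - x j) (by fun_prop)
    (A := fun y k => y.1 k + (if k = j then 1 else if k = i then -1 else 0) * y.2 ())
    (by fun_prop)).congr fun x => ?_
  ext k
  simp only [compareExchange, reluMap, relu]
  by_cases h : x i ≤ x j
  · simp [h]
  · have h' : max (x i - x j) 0 = x i - x j := max_eq_left (by linarith)
    simp only [h, if_false, h', Function.comp]
    by_cases hj : k = j
    · subst hj; simp
    · by_cases hi : k = i
      · subst hi; simp [hij]
      · simp [hi, hj, Equiv.swap_apply_of_ne_of_ne hi hj]

theorem compareExchange_eq_comp {p : ℕ} (i j : Fin p) (x : Fin p → ℝ) :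
    ∃ σ : Equiv.Perm (Fin p), compareExchange i j x = x ∘ σ := by
  unfold compareExchange
  split_ifs
  · exact ⟨1, rfl⟩
  · exact ⟨_, rfl⟩

/-- One pass of comparisons of neighbours moves a largest entry to the position `j`. -/
theorem exists_bubble {p w : ℕ} (hw : 2 * (p + 1) + 1 ≤ w) (j : ℕ) (hj : j < p + 1) :
    ∃ P : (Fin (p + 1) → ℝ) → Fin (p + 1) → ℝ, NN (List.replicate j w) P ∧
      ∀ x, (∃ σ : Equiv.Perm (Fin (p + 1)), P x = x ∘ σ) ∧
        ∀ i, i ≤ ⟨j, hj⟩ → P x i ≤ P x ⟨j, hj⟩ := by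
  induction j with
  | zero =>
    refine ⟨fun x => x, IsAff.id', fun x => ⟨⟨1, rfl⟩, fun i hi => ?_⟩⟩
    rw [show i = ⟨0, hj⟩ from le_antisymm hi (Fin.mk_le_of_le_val (Nat.zero_le _))]
  | succ j ih =>
    obtain ⟨P, hP, h⟩ := ih (by omega)
    set u : Fin (p + 1) := ⟨j, by omega⟩
    set u' : Fin (p + 1) := ⟨j + 1, hj⟩
    have huu : u ≠ u' := by simp [u, u']
    refine ⟨fun x => compareExchange u u' (P x), ?_, fun x => ⟨?_, ?_⟩⟩
    · exact NN.comp_replicate (L' := 1) (nn_compareExchange hw huu) hP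
    · obtain ⟨σ, hσ⟩ := (h x).1
      obtain ⟨τ, hτ⟩ := compareExchange_eq_comp u u' (P x)
      exact ⟨τ.trans σ, hτ.trans (by rw [hσ]; rfl)⟩
    · intro i hi
      have hlt : i ≠ u' → i ≤ u := by
        intro h1
        rw [Fin.le_def] at hi ⊢
        have : (i : ℕ) ≠ j + 1 := fun h2 => h1 (Fin.ext h2)
        simp only [u', u] at hi ⊢
        omega
      have h2 := (h x).2
      simp only [compareExchange]
      split_ifs with hc
      · by_cases h1 : i = u'
        · rw [h1]
        · exact (h2 i (hlt h1)).trans hc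
      · simp only [Function.comp, Equiv.swap_apply_right]
        by_cases h1 : i = u'
        · rw [h1, Equiv.swap_apply_right]
        · by_cases h3 : i = u
          · rw [h3, Equiv.swap_apply_left]; linarith
          · rw [Equiv.swap_apply_of_ne_of_ne h3 h1]; exact h2 i (hlt h1)

/-- The number of entries of a tuple with a given property. -/
noncomputable def countP {p : ℕ} (P : ℝ → Prop) (x : Fin p → ℝ) : ℕ := Nat.card {i // P (x i)}

theorem countP_comp_perm {p : ℕ} (P : ℝ → Prop) (x : Fin p → ℝ) (σ : Equiv.Perm (Fin p)) :
    countP P (x ∘ σ) = countP P x :=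
  Nat.card_congr (σ.subtypeEquiv fun _ => Iff.rfl)

open Classical in
theorem countP_eq_card {p : ℕ} (P : ℝ → Prop) (x : Fin p → ℝ) :
    countP P x = (Finset.univ.filter fun i => P (x i)).card := by
  rw [countP, Nat.card_eq_fintype_card, Fintype.card_subtype]

open Classical in
theorem countP_succ {p : ℕ} (P : ℝ → Prop) (x : Fin (p + 1) → ℝ) :
    countP P x = countP P (x ∘ Fin.castSucc) + if P (x (Fin.last p)) then 1 else 0 := by
  simp only [countP_eq_card, Finset.card_filter, Fin.sum_univ_castSucc, Function.comp]

/-- Delete a largest entry of a tuple. -/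
theorem exists_dropMax {p w : ℕ} (hw : 2 * (p + 1) + 1 ≤ w) :
    ∃ D : (Fin (p + 1) → ℝ) → Fin p → ℝ, NN (List.replicate p w) D ∧
      ∀ x c, countP (· < c) (D x) ≤ countP (· < c) x ∧
        countP (c < ·) (D x) ≤ countP (c < ·) x - 1 := by
  obtain ⟨P, hP, h⟩ := exists_bubble hw p (Nat.lt_succ_self p)
  refine ⟨fun x => P x ∘ Fin.castSucc, hP.postcomp (T := fun y => y ∘ Fin.castSucc)
    (by unfold Function.comp; fun_prop), fun x c => ?_⟩
  obtain ⟨⟨σ, hσ⟩, hmax⟩ := h x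
  have e : ∀ Q, countP Q x = countP Q (P x) := fun Q => by rw [hσ, countP_comp_perm]
  rw [e, e, countP_succ, countP_succ (c < ·)]
  refine ⟨Nat.le_add_right _ _, ?_⟩
  split_ifs with hc
  · simp
  · have : countP (c < ·) (P x ∘ Fin.castSucc) = 0 := by
      rw [countP_eq_card, Finset.card_eq_zero, Finset.filter_eq_empty_iff]
      intro i _ hi
      exact hc (lt_of_lt_of_le hi (hmax _ (Fin.le_last _)))
    simp [this]

theorem countP_neg {p : ℕ} (P : ℝ → Prop) (x : Fin p → ℝ) :
    countP P (fun i => -x i) = countP (fun t => P (-t)) x := rfl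

/-- Delete a smallest entry of a tuple. -/
theorem exists_dropMin {p w : ℕ} (hw : 2 * (p + 1) + 1 ≤ w) :
    ∃ D : (Fin (p + 1) → ℝ) → Fin p → ℝ, NN (List.replicate p w) D ∧
      ∀ x c, countP (· < c) (D x) ≤ countP (· < c) x - 1 ∧
        countP (c < ·) (D x) ≤ countP (c < ·) x := by
  obtain ⟨D, hD, h⟩ := exists_dropMax hw
  refine ⟨fun x i => -D (fun j => -x j) i, ?_, fun x c => ?_⟩
  · exact (hD.precomp (T := fun (x : Fin (p + 1) → ℝ) j => -x j) (by fun_prop)).postcomp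
      (T := fun (y : Fin p → ℝ) j => -y j) (by fun_prop)
  · have h1 := (h (fun j => -x j) (-c)).2
    have h2 := (h (fun j => -x j) (-c)).1
    rw [countP_neg] at h1 h2
    rw [countP_neg, countP_neg]
    simp only [neg_lt_neg_iff] at h1 h2
    simp only [lt_neg, neg_lt] at h1 h2 ⊢
    exact ⟨h1, h2⟩

/-- The median of `2 a + 1` numbers, found by deleting `a` times a largest and a smallest one. -/
theorem exists_nn_median (a : ℕ) {w : ℕ} (hw : 2 * (2 * a + 1) + 1 ≤ w) :
    ∃ (L : ℕ) (F : (Fin (2 * a + 1) → ℝ) → ℝ), L ≤ (2 * a + 1) ^ 2 ∧ NN (List.replicate L w) F ∧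
      ∀ x c, (countP (· < c) x ≤ a → c ≤ F x) ∧ (countP (c < ·) x ≤ a → F x ≤ c) := by
  induction a with
  | zero =>
    refine ⟨0, fun x => x 0, by simp, (IsAff.apply 0 : IsAff fun x : Fin 1 → ℝ => x 0),
      fun x c => ⟨fun h => ?_, fun h => ?_⟩⟩
    all_goals
      rw [countP_eq_card, Nat.le_zero, Finset.card_eq_zero, Finset.filter_eq_empty_iff] at h
      exact not_lt.1 (h (Finset.mem_univ 0))
  | succ a ih =>
    obtain ⟨L, F, hL, hF, h⟩ := ih (by omega)
    obtain ⟨D, hD, hd⟩ := exists_dropMax (p := 2 * a + 2) (w := w) (by omega)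
    obtain ⟨D', hD', hd'⟩ := exists_dropMin (p := 2 * a + 1) (w := w) (by omega)
    refine ⟨2 * a + 2 + (2 * a + 1) + L, fun x => F (D' (D x)), by nlinarith, ?_, fun x c => ?_⟩
    · exact hF.comp_replicate (hD'.comp_replicate hD)
    · have h1 := hd x c
      have h2 := hd' (D x) c
      exact ⟨fun h3 => (h _ c).1 (by omega), fun h3 => (h _ c).2 (by omega)⟩

/-- If more than half of the channels are accurate, then so is the median. -/
theorem abs_sub_le_of_median {a : ℕ} {F : (Fin (2 * a + 1) → ℝ) → ℝ}
    (hF : ∀ x c, (countP (· < c) x ≤ a → c ≤ F x) ∧ (countP (c < ·) x ≤ a → F x ≤ c))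
    {x : Fin (2 * a + 1) → ℝ} {y ε : ℝ} (B : Finset (Fin (2 * a + 1))) (hB : B.card ≤ a)
    (hx : ∀ k ∉ B, |y - x k| ≤ ε) : |y - F x| ≤ ε := by
  classical
  have key : ∀ P : ℝ → Prop, (∀ k ∉ B, ¬P (x k)) → countP P x ≤ a := by
    intro P hP
    rw [countP_eq_card]
    refine (Finset.card_le_card fun k hk => ?_).trans hB
    by_contra hkB
    exact hP k hkB (Finset.mem_filter.1 hk).2
  have h1 : y - ε ≤ F x := (hF x _).1 (key _ fun k hk => by
    have := abs_le.1 (hx k hk); simp only [not_lt]; linarith)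
  have h2 : F x ≤ y + ε := (hF x _).2 (key _ fun k hk => by
    have := abs_le.1 (hx k hk); simp only [not_lt]; linarith)
  rw [abs_le]
  constructor <;> linarith

end IntrinsicReLU

/-! ### Shifted grids -/

namespace IntrinsicReLU

/-- The continuous step of width `η`: it is `0` up to `-η` and `1` from `0` on. -/
noncomputable def ramp (η s : ℝ) : ℝ := relu (s / η + 1) - relu (s / η)

theorem ramp_of_nonneg {η s : ℝ} (hη : 0 < η) (hs : 0 ≤ s) : ramp η s = 1 := by
  have : 0 ≤ s / η := by positivity
  rw [ramp, relu, relu, max_eq_left this, max_eq_left (by linarith)]; ring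

theorem ramp_of_le {η s : ℝ} (hη : 0 < η) (hs : s ≤ -η) : ramp η s = 0 := by
  have : s / η ≤ -1 := by rw [div_le_iff₀ hη]; linarith
  rw [ramp, relu, relu, max_eq_right (by linarith), max_eq_right (by linarith)]; ring

theorem ramp_nonneg (η s : ℝ) : 0 ≤ ramp η s :=
  sub_nonneg.2 (max_le_max (by linarith) le_rfl)

/-- The number of the cell of the grid `q ℤ - k` that contains `y`. -/
noncomputable def cell (q k : ℕ) (y : ℝ) : ℕ := ⌊(y + k) / q⌋₊

/-- The grid `q ℤ - k` does not cut the interval `[b, b + 1]`: no grid point lies in `(b, b + 1]`.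
The only integer in this interval is `⌊b⌋ + 1`. -/
def Avoids (q k : ℕ) (b : ℝ) : Prop := ¬(q : ℤ) ∣ ⌊b⌋ + 1 + k

/-- On an interval that is not cut, `y` stays away from the jumps at the grid points. -/
theorem Avoids.threshold {q k : ℕ} {b y : ℝ} (h : Avoids q k b) (h1 : b ≤ y) (h2 : y ≤ b + 1)
    (j : ℤ) : (q * j : ℝ) ≤ y + k ∧ (q * j : ℝ) ≤ b + k ∨ y + k ≤ q * j - (1 - Int.fract b) := by
  have hb := Int.floor_add_fract b
  have hb0 := Int.fract_nonneg b
  rcases lt_trichotomy ((q : ℤ) * j) (⌊b⌋ + 1 + k) with hj | hj | hj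
  · left
    have : (q : ℤ) * j ≤ ⌊b⌋ + k := by omega
    have : (q * j : ℝ) ≤ ⌊b⌋ + k := by exact_mod_cast this
    constructor <;> linarith
  · exact absurd ⟨j, hj.symm⟩ h
  · right
    have : ⌊b⌋ + 2 + k ≤ (q : ℤ) * j := by omega
    have : (⌊b⌋ + 2 + k : ℝ) ≤ q * j := by exact_mod_cast this
    linarith

theorem Avoids.cell_eq {q k : ℕ} (hq : 0 < q) {b y : ℝ} (h : Avoids q k b) (h1 : b ≤ y)
    (h2 : y ≤ b + 1) : cell q k y = cell q k b := by
  have hq' : (0 : ℝ) < q := by exact_mod_cast hq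
  refine le_antisymm ?_ (Nat.floor_mono (by gcongr))
  rcases Nat.eq_zero_or_pos (cell q k y) with h0 | h0
  · omega
  refine (Nat.le_floor_iff' h0.ne').2 ?_
  have h3 : ((cell q k y : ℕ) : ℝ) ≤ (y + k) / q := (Nat.le_floor_iff' h0.ne').1 le_rfl
  rw [le_div_iff₀ hq'] at h3 ⊢
  rcases h.threshold h1 h2 (cell q k y) with h4 | h4
  · push_cast at h4; linarith
  · have := Int.fract_lt_one b
    push_cast at h4; linarith

theorem Avoids.ramp_eq {q k : ℕ} {b y : ℝ} (h : Avoids q k b) (h1 : b ≤ y)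
    (h2 : y ≤ b + 1) {η : ℝ} (hη : 0 < η) (hηb : η ≤ 1 - Int.fract b) (j : ℕ) :
    ramp η (y + k - q * j) = if (q * j : ℝ) ≤ y + k then 1 else 0 := by
  rcases h.threshold h1 h2 j with h4 | h4
  · push_cast at h4
    rw [if_pos h4.1, ramp_of_nonneg hη (by linarith [h4.1])]
  · push_cast at h4
    rw [if_neg (by linarith), ramp_of_le hη (by linarith)]

/-- The cell number is the number of grid points passed. -/
theorem Avoids.sum_ramp_eq {q k M : ℕ} (hq : 0 < q) {b y : ℝ} (h : Avoids q k b) (h1 : b ≤ y)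
    (h2 : y ≤ b + 1) {η : ℝ} (hη : 0 < η) (hηb : η ≤ 1 - Int.fract b) (hM : y + k < q * (M + 1)) :
    ∑ l ∈ Finset.range M, ramp η (y + k - q * (l + 1 : ℕ)) = cell q k y := by
  have hq' : (0 : ℝ) < q := by exact_mod_cast hq
  have e : ∀ l : ℕ, ramp η (y + k - q * (l + 1 : ℕ)) = if l < cell q k y then 1 else 0 := by
    intro l
    rw [h.ramp_eq h1 h2 hη hηb (l + 1)]
    refine if_congr ?_ rfl rfl
    rw [← Nat.succ_le_iff, cell, Nat.le_floor_iff' (Nat.succ_ne_zero l), le_div_iff₀ hq', mul_comm]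
  have hle : cell q k y ≤ M := by
    rw [← Nat.lt_succ_iff]
    refine Nat.floor_lt' (Nat.succ_ne_zero M) |>.2 ?_
    rw [div_lt_iff₀ hq', mul_comm]
    exact_mod_cast hM
  simp only [e, Finset.sum_boole]
  congr 1
  rw [show (Finset.range M).filter (· < cell q k y) = Finset.range (cell q k y) by
    ext l; simp only [Finset.mem_filter, Finset.mem_range]; omega, Finset.card_range]

theorem abs_sub_le_of_cell_eq {q k : ℕ} (hq : 0 < q) {y y' : ℝ} (hy : 0 ≤ y) (hy' : 0 ≤ y') {t : ℕ}
    (h : cell q k y / 2 ^ t = cell q k y' / 2 ^ t) : |y - y'| ≤ q * 2 ^ t := by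
  have hq' : (0 : ℝ) < q := by exact_mod_cast hq
  have key : ∀ {y y' : ℝ}, 0 ≤ y → 0 ≤ y' → cell q k y / 2 ^ t = cell q k y' / 2 ^ t →
      y - y' ≤ q * 2 ^ t := by
    intro y y' hy hy' h
    have h1 : (cell q k y' : ℝ) ≤ (y' + k) / q := Nat.floor_le (by positivity)
    have h2 : (y + k) / q < cell q k y + 1 := Nat.lt_floor_add_one _
    have h3 : cell q k y + 1 ≤ cell q k y' + 2 ^ t := by
      have e1 := Nat.div_add_mod (cell q k y) (2 ^ t)
      have e2 := Nat.div_add_mod (cell q k y') (2 ^ t)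
      have e3 := Nat.mod_lt (cell q k y) (Nat.two_pow_pos t)
      rw [h] at e1
      omega
    have h3' : (cell q k y + 1 : ℝ) ≤ cell q k y' + 2 ^ t := by exact_mod_cast h3
    rw [le_div_iff₀ hq'] at h1
    rw [div_lt_iff₀ hq'] at h2
    nlinarith
  rw [abs_le]
  constructor
  · linarith [key hy' hy h.symm]
  · exact key hy hy' h

open Classical in
/-- For every coordinate of a box at most one of the `q` shifted grids is not avoided. -/
theorem card_not_avoids_le {n : ℕ} (q : ℕ) (b : Fin n → ℝ) :
    (Finset.univ.filter fun k : Fin q => ¬∀ i, Avoids q k (b i)).card ≤ n := by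
  calc (Finset.univ.filter fun k : Fin q => ¬∀ i, Avoids q k (b i)).card
      ≤ ((Finset.univ : Finset (Fin n)).biUnion fun i =>
          Finset.univ.filter fun k : Fin q => ¬Avoids q k (b i)).card := by
        refine Finset.card_le_card fun k hk => ?_
        simpa using hk
    _ ≤ ∑ i : Fin n, (Finset.univ.filter fun k : Fin q => ¬Avoids q k (b i)).card :=
        Finset.card_biUnion_le
    _ ≤ ∑ _i : Fin n, 1 := by
        refine Finset.sum_le_sum fun i _ => Finset.card_le_one.2 fun k hk k' hk' => ?_
        simp only [Finset.mem_filter, Finset.mem_univ, true_and, Avoids, not_not] at hk hk'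
        have h1 : (q : ℤ) ∣ (k : ℤ) - k' := by
          have := dvd_sub hk hk'
          rwa [add_sub_add_left_eq_sub] at this
        have h2 := Int.eq_zero_of_abs_lt_dvd h1 (by
          have := k.2; have := k'.2; rw [abs_lt]; constructor <;> omega)
        exact Fin.ext (by omega)
    _ = n := by simp

open Classical in
/-- If each set `B j` contains less than a third of all shifts, then `2 a + 1` shifts can be drawn,
with repetition, such that no `B j` contains more than `a` of them. For each `j`, the drawings that
violate this are counted with the weight `2 ^ r`, where `r` is the number of shifts in `B j`; the
sum of the weights of all drawings is `(q + card (B j)) ^ (2 * a + 1)`. -/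
theorem exists_shifts_of_card_lt {n a q : ℕ} (hq : 3 * n < q) {ι : Type} [Fintype ι]
    (ha : 2 * Fintype.card ι * 8 ^ a < 3 * 9 ^ a) (B : ι → Finset (Fin q))
    (hB : ∀ j, (B j).card ≤ n) :
    ∃ t : Fin (2 * a + 1) → Fin q, ∀ j,
      (Finset.univ.filter fun s => t s ∈ B j).card ≤ a := by
  by_contra! hcon
  have hcount : ∀ j, (Finset.univ.filter fun t : Fin (2 * a + 1) → Fin q =>
      a < (Finset.univ.filter fun s => t s ∈ B j).card).card * 2 ^ (a + 1) * 3 ^ (2 * a + 1) ≤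
        4 ^ (2 * a + 1) * q ^ (2 * a + 1) := by
    intro j
    have h1 : ∑ t : Fin (2 * a + 1) → Fin q, ∏ s, (if t s ∈ B j then 2 else 1 : ℕ) =
        (q + (B j).card) ^ (2 * a + 1) := by
      have h := Finset.sum_pow' (Finset.univ : Finset (Fin q))
        (fun k => (if k ∈ B j then 2 else 1 : ℕ)) (2 * a + 1)
      rw [Fintype.piFinset_univ] at h
      rw [← h]
      congr 1
      calc ∑ k : Fin q, (if k ∈ B j then 2 else 1 : ℕ)
          = ∑ k : Fin q, (1 + if k ∈ B j then 1 else 0) :=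
            Finset.sum_congr rfl fun k _ => by split_ifs <;> rfl
        _ = q + (B j).card := by simp [Finset.sum_add_distrib]
    have h2 : (Finset.univ.filter fun t : Fin (2 * a + 1) → Fin q =>
        a < (Finset.univ.filter fun s => t s ∈ B j).card).card * 2 ^ (a + 1) ≤
          (q + (B j).card) ^ (2 * a + 1) := by
      rw [← h1, ← smul_eq_mul, ← Finset.sum_const]
      refine (Finset.sum_le_sum fun t ht => ?_).trans
        (Finset.sum_le_sum_of_subset (Finset.filter_subset _ _))
      rw [Finset.prod_ite, Finset.prod_const, Finset.prod_const_one, mul_one]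
      exact Nat.pow_le_pow_right (by norm_num) (Finset.mem_filter.1 ht).2
    calc _ ≤ (q + (B j).card) ^ (2 * a + 1) * 3 ^ (2 * a + 1) := Nat.mul_le_mul_right _ h2
      _ = (3 * (q + (B j).card)) ^ (2 * a + 1) := by rw [mul_comm, mul_pow]
      _ ≤ (4 * q) ^ (2 * a + 1) := by
        refine Nat.pow_le_pow_left ?_ _
        have := hB j
        omega
      _ = _ := mul_pow _ _ _
  have hall : q ^ (2 * a + 1) ≤ ∑ j, (Finset.univ.filter fun t : Fin (2 * a + 1) → Fin q =>
      a < (Finset.univ.filter fun s => t s ∈ B j).card).card := by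
    calc q ^ (2 * a + 1) = (Finset.univ : Finset (Fin (2 * a + 1) → Fin q)).card := by simp
      _ ≤ (Finset.univ.biUnion fun j => Finset.univ.filter fun t : Fin (2 * a + 1) → Fin q =>
          a < (Finset.univ.filter fun s => t s ∈ B j).card).card := by
        refine Finset.card_le_card fun t _ => ?_
        obtain ⟨j, hj⟩ := hcon t
        simpa using ⟨j, hj⟩
      _ ≤ _ := Finset.card_biUnion_le
  have hsum : q ^ (2 * a + 1) * (2 ^ (a + 1) * 3 ^ (2 * a + 1)) ≤
      Fintype.card ι * (4 ^ (2 * a + 1) * q ^ (2 * a + 1)) := by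
    refine (Nat.mul_le_mul_right _ hall).trans ?_
    rw [Finset.sum_mul]
    refine (Finset.sum_le_sum fun j _ => (mul_assoc _ _ _).symm.le.trans (hcount j)).trans ?_
    simp
  have hq0 : 0 < q ^ (2 * a + 1) := Nat.pow_pos (by omega)
  have h3 : 2 ^ (a + 1) * 3 ^ (2 * a + 1) ≤ Fintype.card ι * 4 ^ (2 * a + 1) := by
    refine Nat.le_of_mul_le_mul_left (le_trans hsum (le_of_eq ?_)) hq0
    ring
  have e1 : (2 : ℕ) ^ (a + 1) * 3 ^ (2 * a + 1) = 2 ^ (a + 1) * (3 * 9 ^ a) := by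
    rw [pow_succ 3, pow_mul]; ring
  have e2 : Fintype.card ι * 4 ^ (2 * a + 1) = 2 ^ (a + 1) * (2 * Fintype.card ι * 8 ^ a) := by
    rw [show (4 : ℕ) = 2 ^ 2 by norm_num, show (8 : ℕ) = 2 ^ 3 by norm_num, ← pow_mul, ← pow_mul]
    ring
  rw [e1, e2] at h3
  have := Nat.le_of_mul_le_mul_left h3 (Nat.two_pow_pos _)
  omega

open Classical in
/-- Few shifts suffice: the first `2 n + 1` shifts do, and so does a random choice of a multiple of
`log N` shifts. -/
theorem exists_shifts {n N : ℕ} {ι : Type} [Fintype ι] (hN : Fintype.card ι ≤ N)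
    (B : ι → Finset (Fin (3 * n + 1))) (hB : ∀ j, (B j).card ≤ n) :
    ∃ (a : ℕ) (t : Fin (2 * a + 1) → Fin (3 * n + 1)), a ≤ n ∧ a ≤ 6 * (Nat.log 2 N + 1) ∧
      ∀ j, (Finset.univ.filter fun s => t s ∈ B j).card ≤ a := by
  rcases le_total n (6 * (Nat.log 2 N + 1)) with h | h
  · refine ⟨n, fun s => Fin.castLE (by omega) s, le_rfl, h, fun j => le_trans ?_ (hB j)⟩
    refine Finset.card_le_card_of_injOn (fun s => Fin.castLE (by omega) s) (fun s hs => ?_)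
      (fun s _ s' _ h => Fin.castLE_injective _ h)
    simpa using hs
  · have h1 : N < 2 ^ (Nat.log 2 N + 1) := Nat.lt_pow_succ_log_self (by norm_num) N
    -- the factor `6` makes `2 * 8 ^ 6 ≤ 9 ^ 6`
    have h2 : 2 * Fintype.card ι * 8 ^ (6 * (Nat.log 2 N + 1)) <
        3 * 9 ^ (6 * (Nat.log 2 N + 1)) := by
      calc 2 * Fintype.card ι * 8 ^ (6 * (Nat.log 2 N + 1))
          ≤ 2 * (N * 8 ^ (6 * (Nat.log 2 N + 1))) := by rw [mul_assoc]; gcongr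
        _ < 2 * (2 ^ (Nat.log 2 N + 1) * 8 ^ (6 * (Nat.log 2 N + 1))) := by gcongr
        _ = 2 * (2 * 8 ^ 6) ^ (Nat.log 2 N + 1) := by rw [mul_pow, pow_mul]
        _ ≤ 2 * (9 ^ 6) ^ (Nat.log 2 N + 1) := by gcongr; norm_num
        _ = 2 * 9 ^ (6 * (Nat.log 2 N + 1)) := by rw [pow_mul]
        _ ≤ 3 * 9 ^ (6 * (Nat.log 2 N + 1)) := by gcongr; norm_num
    obtain ⟨t, ht⟩ := exists_shifts_of_card_lt (Nat.lt_succ_self (3 * n)) h2 B hB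
    exact ⟨_, t, h, le_rfl, ht⟩

/-- For fewer than `M` nonzero integer vectors there is a functional with coefficients below `M`
that vanishes at none of them. -/
theorem exists_weights_ne_zero {n M : ℕ} (D : Finset (Fin n → ℤ)) (hD : D.card < M)
    (h0 : ∀ d ∈ D, d ≠ 0) :
    ∃ w : Fin n → ℕ, (∀ i, w i < M) ∧ ∀ d ∈ D, ∑ i, (w i : ℤ) * d i ≠ 0 := by
  classical
  induction n with
  | zero =>
    exact ⟨fun _ => 0, fun i => i.elim0, fun d hd => absurd (Subsingleton.elim d 0) (h0 d hd)⟩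
  | succ n ih =>
    obtain ⟨w, hw, hwD⟩ := ih ((D.image Fin.tail).filter (· ≠ 0))
      (((Finset.card_filter_le _ _).trans Finset.card_image_le).trans_lt hD)
      (fun d hd => (Finset.mem_filter.1 hd).2)
    -- the first weight has to avoid one value for each vector with nonzero first coordinate
    let bad : (Fin (n + 1) → ℤ) → ℕ := fun d =>
      (-(∑ i, (w i : ℤ) * d i.succ) / d 0).toNat
    obtain ⟨w₀, hw₀, hbad⟩ : ∃ w₀ ∈ Finset.range M, w₀ ∉ D.image bad :=
      Finset.exists_mem_notMem_of_card_lt_card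
        (by rw [Finset.card_range]; exact Finset.card_image_le.trans_lt hD)
    refine ⟨Fin.cons w₀ w, fun i => ?_, fun d hd hsum => ?_⟩
    · refine Fin.cases ?_ (fun i => ?_) i
      · simpa using hw₀
      · simpa using hw i
    · rw [Fin.sum_univ_succ] at hsum
      simp only [Fin.cons_zero, Fin.cons_succ] at hsum
      by_cases hd0 : d 0 = 0
      · rw [hd0, mul_zero, zero_add] at hsum
        refine hwD (Fin.tail d) (Finset.mem_filter.2
          ⟨Finset.mem_image_of_mem _ hd, fun ht => ?_⟩) hsum
        refine h0 d hd (funext fun i => ?_)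
        refine Fin.cases hd0 (fun i => ?_) i
        exact congrFun ht i
      · refine hbad (Finset.mem_image.2 ⟨d, hd, ?_⟩)
        simp only [bad]
        rw [show -(∑ i, (w i : ℤ) * d i.succ) = w₀ * d 0 by linarith, Int.mul_ediv_cancel _ hd0,
          Int.toNat_natCast]

/-- Vectors of natural numbers are told apart by a functional with small natural coefficients. -/
theorem exists_weights_injOn {n : ℕ} (V : Finset (Fin n → ℕ)) :
    ∃ w : Fin n → ℕ, (∀ i, w i ≤ V.card ^ 2) ∧
      Set.InjOn (fun x : Fin n → ℕ => ∑ i, w i * x i) (V : Set (Fin n → ℕ)) := by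
  classical
  obtain ⟨w, hw, h⟩ := exists_weights_ne_zero (M := V.card ^ 2 + 1)
    (((V ×ˢ V).image fun z => fun i => (z.1 i : ℤ) - z.2 i).filter (· ≠ 0))
    (Nat.lt_succ_of_le ((Finset.card_filter_le _ _).trans
      (Finset.card_image_le.trans (by rw [Finset.card_product, sq]))))
    (fun d hd => (Finset.mem_filter.1 hd).2)
  refine ⟨w, fun i => Nat.lt_succ_iff.1 (hw i), fun x hx y hy hxy => ?_⟩
  by_contra hne
  refine h (fun i => (x i : ℤ) - y i) (Finset.mem_filter.2 ⟨Finset.mem_image.2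
    ⟨(x, y), Finset.mem_product.2 ⟨hx, hy⟩, rfl⟩, fun h0 => hne (funext fun i => ?_)⟩) ?_
  · have := congrFun h0 i
    simp only [Pi.zero_apply] at this
    omega
  · have : (∑ i, (w i : ℤ) * x i) = ∑ i, (w i : ℤ) * y i := by exact_mod_cast hxy
    simp [mul_sub, Finset.sum_sub_distrib, this]

/-- On a set where `f` oscillates by at most `s`, it is approximated by a multiple of `b` up to
`(s + b) / 2`. -/
theorem exists_label {X : Type} (f : X → ℝ) (A : Set X) {s b : ℝ} (hb : 0 < b)
    (hA : ∀ x ∈ A, ∀ y ∈ A, |f x - f y| ≤ s) :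
    ∃ v : ℤ, ∀ x ∈ A, |f x - b * v| ≤ s / 2 + b / 2 := by
  rcases A.eq_empty_or_nonempty with rfl | hne
  · exact ⟨0, by simp⟩
  obtain ⟨x₀, hx₀⟩ := hne
  have hab : BddAbove (f '' A) := ⟨f x₀ + s, by
    rintro _ ⟨x, hx, rfl⟩; linarith [(abs_le.1 (hA x hx x₀ hx₀)).2]⟩
  have hbb : BddBelow (f '' A) := ⟨f x₀ - s, by
    rintro _ ⟨x, hx, rfl⟩; linarith [(abs_le.1 (hA x hx x₀ hx₀)).1]⟩
  have h1 : sSup (f '' A) ≤ sInf (f '' A) + s := by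
    refine csSup_le ⟨_, x₀, hx₀, rfl⟩ ?_
    rintro _ ⟨x, hx, rfl⟩
    have : f x - s ≤ sInf (f '' A) := by
      refine le_csInf ⟨_, x₀, hx₀, rfl⟩ ?_
      rintro _ ⟨y, hy, rfl⟩
      linarith [(abs_le.1 (hA x hx y hy)).2]
    linarith
  set μ := (sSup (f '' A) + sInf (f '' A)) / 2 with hμ
  refine ⟨round (μ / b), fun x hx => ?_⟩
  have h2 : f x ≤ sSup (f '' A) := le_csSup hab ⟨x, hx, rfl⟩
  have h3 : sInf (f '' A) ≤ f x := csInf_le hbb ⟨x, hx, rfl⟩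
  have h4 : |f x - μ| ≤ s / 2 := by rw [abs_le]; constructor <;> linarith
  have h5 : |μ - b * round (μ / b)| ≤ b / 2 := by
    have h6 := abs_sub_round (μ / b)
    have : μ - b * round (μ / b) = b * (μ / b - round (μ / b)) := by field_simp
    rw [this, abs_mul, abs_of_pos hb]
    nlinarith
  calc |f x - b * round (μ / b)| = |(f x - μ) + (μ - b * round (μ / b))| := by ring_nf
    _ ≤ _ := (abs_add_le _ _).trans (add_le_add h4 h5)

end IntrinsicReLU

/-! ### Approximation on one grid -/

namespace IntrinsicReLU

theorem exists_cover {n : ℕ} {r : ℝ} (hr : 0 < r) {K : Set (Fin n → ℝ)} (hK : K ⊆ cube n) :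
    ∃ t : Finset (Fin n → ℝ), t.card ≤ coveringNum r K ∧
      ∀ x ∈ K, ∃ c ∈ t, ∀ i, |x i - c i| ≤ r := by
  have h := coveringNum_spec hr hK
  have hlt : Metric.externalCoveringNumber r.toNNReal K < (coveringNum r K + 1 : ℕ) := by
    rw [← h]; exact_mod_cast Nat.lt_succ_self _
  unfold Metric.externalCoveringNumber at hlt
  simp only [iInf_lt_iff] at hlt
  obtain ⟨C, hC, hcard⟩ := hlt
  have hfin : C.Finite := Set.encard_lt_top_iff.1 (hcard.trans (ENat.natCast_lt_top _))
  refine ⟨hfin.toFinset, ?_, fun x hx => ?_⟩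
  · rw [hfin.encard_eq_coe_toFinset_card] at hcard
    exact Nat.lt_succ_iff.1 (by exact_mod_cast hcard)
  · obtain ⟨c, hc, hxc⟩ := hC hx
    refine ⟨c, by simpa using hc, fun i => ?_⟩
    have h1 : edist x c ≤ r.toNNReal := hxc
    rw [edist_nndist, ENNReal.coe_le_coe, ← NNReal.coe_le_coe, coe_nndist,
      Real.coe_toNNReal _ hr.le] at h1
    rw [← Real.dist_eq]
    exact (dist_le_pi_dist x c i).trans h1

theorem abs_sub_le_of_modulus {n : ℕ} {f : (Fin n → ℝ) → ℝ} {t : ℝ} (h : modulus f t ≠ ⊤)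
    {x y : Fin n → ℝ} (hx : x ∈ cube n) (hy : y ∈ cube n) (hxy : dist x y ≤ t) :
    |f x - f y| ≤ (modulus f t).toReal := by
  refine (ENNReal.ofReal_le_iff_le_toReal h).1 ?_
  exact le_iSup₂_of_le x hx (le_iSup₂_of_le y hy (le_iSup_of_le hxy le_rfl))

/-- Dividing a segment into equal parts bounds a difference over `j` times the distance. -/
theorem abs_sub_le_mul {n : ℕ} {f : (Fin n → ℝ) → ℝ} {τ W : ℝ}
    (h : ∀ x ∈ cube n, ∀ y ∈ cube n, dist x y ≤ τ → |f x - f y| ≤ W) (j : ℕ) (hj : 0 < j)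
    {x y : Fin n → ℝ} (hx : x ∈ cube n) (hy : y ∈ cube n) (hxy : dist x y ≤ j * τ) :
    |f x - f y| ≤ j * W := by
  induction j, hj using Nat.le_induction generalizing x with
  | base => simpa using h x hx y hy (by simpa using hxy)
  | succ j hj ih =>
    have hj' : (0 : ℝ) < j + 1 := by positivity
    set c : ℝ := 1 / (j + 1) with hc
    have hc0 : 0 ≤ c := by positivity
    have hc1 : c ≤ 1 := by rw [hc, div_le_one hj']; simp
    set z := AffineMap.lineMap x y c with hz
    have hzc : z ∈ cube n := (convex_Icc (0 : Fin n → ℝ) 1).lineMap_mem hx hy ⟨hc0, hc1⟩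
    have h1 : dist x z ≤ τ := by
      rw [hz, dist_left_lineMap, Real.norm_of_nonneg hc0, hc]
      push_cast at hxy
      rw [div_mul_eq_mul_div, one_mul, div_le_iff₀ hj']
      linarith
    have h2 : dist z y ≤ j * τ := by
      rw [hz, dist_lineMap_right, Real.norm_of_nonneg (by linarith)]
      push_cast at hxy
      have : 1 - c = j / (j + 1) := by rw [hc]; field_simp; ring
      rw [this, div_mul_eq_mul_div, div_le_iff₀ hj']
      have hj0 : (0 : ℝ) ≤ j := Nat.cast_nonneg j
      nlinarith
    calc |f x - f y| = |(f x - f z) + (f z - f y)| := by ring_nf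
      _ ≤ W + j * W := (abs_add_le _ _).trans (add_le_add (h x hx z hzc h1) (ih hzc h2))
      _ = (j + 1 : ℕ) * W := by push_cast; ring

theorem chainCost_const (c : ℕ) (l : List ℤ) : Tape.chainCost (fun _ _ => c) l ≤ l.length * c := by
  induction l with
  | nil => simp [Tape.chainCost]
  | cons a l ih =>
    cases l with
    | nil => simp [Tape.chainCost]
    | cons b l =>
      simp only [Tape.chainCost, List.length_cons, add_mul, one_mul] at ih ⊢
      omega

/-- A finite set of keys with increments of at most `B + 1` digits. -/
theorem exists_nn_memorizing_finset {S B : ℕ} (hS : 0 < S) (Z : Finset ℤ) (v : ℤ → ℤ)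
    (hz : ∀ z ∈ Z, ∀ z' ∈ Z, z' - z < 2 ^ (B + 1)) (hv : ∀ z ∈ Z, ∀ z' ∈ Z, v z' - v z < 2 ^ B)
    (hc : Z.card * (B + 1) ≤ S * S) :
    ∃ g : ℝ → ℝ, NN (List.replicate (12 * S) 12) g ∧ ∀ z ∈ Z, g z = v z := by
  have hchain : Z.sort.IsChain (Tape.PairFits v fun _ _ => B) := by
    refine List.Pairwise.isChain ?_
    refine (Z.sortedLT_sort.pairwise).imp_of_mem fun {z z'} h1 h2 h12 => ?_
    rw [Finset.mem_sort] at h1 h2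
    exact ⟨h12, hz _ h1 _ h2, by linarith [hv _ h2 _ h1], hv _ h1 _ h2⟩
  obtain ⟨g, hg, h⟩ := exists_nn_memorizing hS v (fun _ _ => B) Z.sort hchain
    ((chainCost_const _ _).trans (by rwa [Finset.length_sort]))
  exact ⟨g, hg, fun z hz => h z ((Finset.mem_sort _).2 hz)⟩

/-- The numbers of the cells of the coordinates of `x` in the grid of mesh `q g` shifted by
`-k g`. -/
noncomputable def cells {n : ℕ} (q k : ℕ) (g : ℝ) (x : Fin n → ℝ) : Fin n → ℕ :=
  fun i => cell q k (x i / g)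

/-- The point `x` of the cube lies in a box `∏ [b i g, (b i + 1) g]` from the list `T` that the
grid with shift `k` avoids. -/
def InGoodBox {n : ℕ} (T : Finset (Fin n → ℝ)) (q k : ℕ) (g : ℝ) (x : Fin n → ℝ) : Prop :=
  x ∈ cube n ∧ ∃ b ∈ T, (∀ i, b i ≤ x i / g ∧ x i / g ≤ b i + 1) ∧ ∀ i, Avoids q k (b i)

theorem InGoodBox.exists_box {n : ℕ} {T : Finset (Fin n → ℝ)} {q k : ℕ} (hq : 0 < q) {g : ℝ}
    {x : Fin n → ℝ} (h : InGoodBox T q k g x) :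
    ∃ b ∈ T, cells q k g x = fun i => cell q k (b i) := by
  obtain ⟨-, b, hb, h1, h2⟩ := h
  exact ⟨b, hb, funext fun i => (h2 i).cell_eq hq (h1 i).1 (h1 i).2⟩

theorem dist_le_of_cells {n : ℕ} {q k : ℕ} (hq : 0 < q) {g : ℝ} (hg : 0 < g) {x y : Fin n → ℝ}
    (hx : x ∈ cube n) (hy : y ∈ cube n) {t : ℕ}
    (h : ∀ i, cells q k g x i / 2 ^ t = cells q k g y i / 2 ^ t) : dist x y ≤ q * g * 2 ^ t := by
  refine (dist_pi_le_iff (by positivity)).2 fun i => ?_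
  have h1 := abs_sub_le_of_cell_eq hq (div_nonneg (hx.1 i) hg.le) (div_nonneg (hy.1 i) hg.le) (h i)
  rw [← sub_div, abs_div, abs_of_pos hg, div_le_iff₀ hg] at h1
  rw [Real.dist_eq]
  linarith

theorem add_lt_of_mem_cube {n m k : ℕ} (hm : 1 ≤ m) (hk : k ≤ 3 * n) {g : ℝ}
    (hg : g = 1 / (m * (2 * n + 1))) {x : Fin n → ℝ} (hx : x ∈ cube n) (i : Fin n) :
    x i / g + k < (3 * n + 1 : ℕ) * (m + 1 : ℝ) := by
  have h1 : x i / g ≤ m * (2 * n + 1) := by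
    rw [hg, div_div_eq_mul_div, div_one]
    exact mul_le_of_le_one_left (by positivity) (hx.2 i)
  have h2 : (k : ℝ) ≤ 3 * n := by exact_mod_cast hk
  have h3 : (0 : ℝ) ≤ (n : ℝ) * m := by positivity
  have hm0 : (0 : ℝ) < m := by exact_mod_cast hm
  push_cast
  nlinarith

/-- One channel: a functional of the cell numbers separates the cells met by good boxes, and the
approximate values of `f` on these cells are memorized. -/
theorem exists_channel {n m N S k : ℕ} (hn : 1 ≤ n) (hm : 1 ≤ m) (hN : 1 ≤ N) (hS : 0 < S)
    (hk : k ≤ 3 * n) {f : (Fin n → ℝ) → ℝ} {W : ℝ} (hW : 0 ≤ W)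
    (hf : ∀ x ∈ cube n, ∀ y ∈ cube n, dist x y ≤ 1 / (2 * (m : ℝ)) → |f x - f y| ≤ W)
    {g : ℝ} (hg : g = 1 / (m * (2 * n + 1))) (T : Finset (Fin n → ℝ)) (hT : T.card ≤ N)
    (hNS : N * (2 * (Nat.log 2 (n * (2 * m + 1) * N) + 1) + 2) ≤ S * S) :
    ∃ (w : Fin n → ℕ) (H : ℝ → ℝ), NN (List.replicate (12 * S) 12) H ∧
      ∀ x, InGoodBox T (3 * n + 1) k g x →
        |f x - H (∑ i, (w i : ℝ) * cells (3 * n + 1) k g x i)| ≤ 2 * W := by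
  classical
  set q := 3 * n + 1 with hq
  have hq0 : 0 < q := by omega
  have hm0 : (0 : ℝ) < m := by exact_mod_cast hm
  have hg0 : 0 < g := by rw [hg]; positivity
  set B := 2 * (Nat.log 2 (n * (2 * m + 1) * N) + 1) + 1 with hB
  -- the cells met by good boxes; `m` bounds the cell numbers of the points of the cube
  let V : Finset (Fin n → ℕ) := (T.image fun b i => cell q k (b i)).filter fun I => ∀ i, I i ≤ m
  have hVcard : V.card ≤ N := (Finset.card_filter_le _ _).trans (Finset.card_image_le.trans hT)
  have hV : ∀ x, InGoodBox T q k g x → cells q k g x ∈ V := by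
    intro x hx
    obtain ⟨b, hb, hbx⟩ := hx.exists_box hq0
    refine Finset.mem_filter.2 ⟨Finset.mem_image.2 ⟨b, hb, hbx.symm⟩, fun i => ?_⟩
    refine Nat.lt_succ_iff.1 ((Nat.floor_lt' (Nat.succ_ne_zero m)).2 ?_)
    rw [div_lt_iff₀ (by exact_mod_cast hq0), mul_comm]
    exact_mod_cast add_lt_of_mem_cube hm hk hg hx.1 i
  obtain ⟨w, hw, hinj⟩ := exists_weights_injOn V
  let key : (Fin n → ℕ) → ℤ := fun I => ((∑ i, w i * I i : ℕ) : ℤ)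
  have hkey : ∀ I ∈ V, 0 ≤ key I ∧ key I ≤ (n * (N ^ 2 * m) : ℕ) := by
    intro I hI
    refine ⟨Int.natCast_nonneg _, ?_⟩
    have : ∑ i, w i * I i ≤ ∑ _i : Fin n, N ^ 2 * m := by
      refine Finset.sum_le_sum fun i _ => Nat.mul_le_mul ?_ ((Finset.mem_filter.1 hI).2 i)
      exact (hw i).trans (Nat.pow_le_pow_left hVcard 2)
    simp only [Finset.sum_const, Finset.card_univ, Fintype.card_fin, smul_eq_mul] at this
    exact Int.ofNat_le.2 this
  -- a cell has sides `(3 n + 1) g ≤ 3 / (2 m)`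
  have hosc : ∀ x y, InGoodBox T q k g x → InGoodBox T q k g y →
      key (cells q k g x) = key (cells q k g y) → |f x - f y| ≤ 3 * W := by
    intro x y hx hy hxy
    have h1 : cells q k g x = cells q k g y :=
      hinj (hV x hx) (hV y hy) (Int.natCast_inj.1 hxy)
    have h2 := dist_le_of_cells (t := 0) hq0 hg0 hx.1 hy.1 (fun i => by rw [h1])
    refine (abs_sub_le_mul hf 3 (by norm_num) hx.1 hy.1 (h2.trans ?_)).trans (by norm_num)
    rw [hg, hq]
    push_cast
    have : (0 : ℝ) ≤ n := Nat.cast_nonneg n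
    rw [pow_zero, mul_one, mul_one_div, mul_one_div,
      div_le_div_iff₀ (by positivity) (by positivity)]
    nlinarith
  have h0 : (0 : Fin n → ℝ) ∈ cube n := ⟨le_rfl, fun _ => zero_le_one⟩
  have hf0 : ∀ x ∈ cube n, |f x - f 0| ≤ 2 * m * W := by
    intro x hx
    refine (abs_sub_le_mul hf (2 * m) (by omega) hx h0 ?_).trans (by push_cast; rfl)
    push_cast
    rw [mul_one_div, div_self (by positivity)]
    refine (dist_pi_le_iff zero_le_one).2 fun i => ?_
    rw [Real.dist_eq, Pi.zero_apply, sub_zero, abs_of_nonneg (hx.1 i)]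
    exact hx.2 i
  -- the labels are multiples of `W`, counted from `f 0` to keep them bounded; if `W = 0`, then `f`
  -- is constant
  have hlab : ∀ z : ℤ, ∃ v : ℤ, |v| ≤ 2 * m + 2 ∧
      ∀ x, InGoodBox T q k g x → key (cells q k g x) = z → |f x - (f 0 + W * v)| ≤ 2 * W := by
    intro z
    rcases hW.eq_or_lt with hW0 | hW0
    · refine ⟨0, by simp; positivity, fun x hx _ => ?_⟩
      have := hf0 x hx.1
      rw [← hW0] at this ⊢
      simpa using this
    by_cases hne : ∃ x, InGoodBox T q k g x ∧ key (cells q k g x) = z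
    · obtain ⟨v, hv⟩ := exists_label (fun x => f x - f 0)
        {x | InGoodBox T q k g x ∧ key (cells q k g x) = z} (s := 3 * W) hW0 (by
          rintro x ⟨hx, hx'⟩ y ⟨hy, hy'⟩
          simpa using hosc x y hx hy (hx'.trans hy'.symm))
      have hv' : ∀ x, InGoodBox T q k g x → key (cells q k g x) = z →
          |f x - (f 0 + W * v)| ≤ 2 * W := by
        intro x hx hxz
        have := hv x ⟨hx, hxz⟩
        rw [← sub_sub]
        linarith
      refine ⟨v, ?_, hv'⟩
      obtain ⟨x, hx, hxz⟩ := hne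
      have h1 := abs_le.1 (hv' x hx hxz)
      have h2 := abs_le.1 (hf0 x hx.1)
      have h3 : (v : ℝ) ≤ 2 * m + 2 := by
        refine le_of_mul_le_mul_left ?_ hW0; linarith [h1.1, h2.2]
      have h4 : -(2 * m + 2 : ℝ) ≤ v := by
        refine le_of_mul_le_mul_left ?_ hW0; linarith [h1.2, h2.1]
      rw [abs_le]
      exact ⟨by exact_mod_cast h4, by exact_mod_cast h3⟩
    · exact ⟨0, by simp; positivity, fun x hx hxz => absurd ⟨x, hx, hxz⟩ hne⟩
  choose v hvb hv using hlab
  -- differences of keys and of labels are at most `2 Λ ^ 2`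
  set Λ := n * (2 * m + 1) * N with hΛ
  have hΛ2 : 2 * Λ ^ 2 < 2 ^ B := by
    have h1 : Λ < 2 ^ (Nat.log 2 Λ + 1) := Nat.lt_pow_succ_log_self (by norm_num) Λ
    have h2 : Λ ^ 2 < (2 ^ (Nat.log 2 Λ + 1)) ^ 2 := Nat.pow_lt_pow_left h1 (by norm_num)
    rw [hB, pow_succ 2, mul_comm 2 (Nat.log 2 Λ + 1), pow_mul]
    omega
  have hΛm : 2 * m + 1 ≤ Λ := by
    have : 1 * (2 * m + 1) * 1 ≤ n * (2 * m + 1) * N := by gcongr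
    omega
  have hΛN : n * (N ^ 2 * m) ≤ Λ ^ 2 := by
    have h1 : n ≤ n ^ 2 := Nat.le_self_pow (by norm_num) n
    have h2 : m ≤ (2 * m + 1) ^ 2 := by nlinarith
    calc n * (N ^ 2 * m) ≤ n ^ 2 * (N ^ 2 * (2 * m + 1) ^ 2) := by gcongr
      _ = Λ ^ 2 := by rw [hΛ]; ring
  have hz : ∀ z ∈ V.image key, ∀ z' ∈ V.image key, z' - z < 2 ^ (B + 1) := by
    intro z hz z' hz'
    obtain ⟨I, hI, rfl⟩ := Finset.mem_image.1 hz
    obtain ⟨I', hI', rfl⟩ := Finset.mem_image.1 hz'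
    have h1 := (hkey I hI).1
    have h2 := (hkey I' hI').2
    have h3 : ((n * (N ^ 2 * m) : ℕ) : ℤ) ≤ (Λ ^ 2 : ℕ) := by exact_mod_cast hΛN
    have h4 : ((2 * Λ ^ 2 : ℕ) : ℤ) < (2 ^ B : ℕ) := by exact_mod_cast hΛ2
    push_cast at h2 h3 h4
    rw [pow_succ]
    nlinarith [sq_nonneg (Λ : ℤ)]
  have hvz : ∀ z ∈ V.image key, ∀ z' ∈ V.image key, v z' - v z < 2 ^ B := by
    intro z _ z' _
    have h1 := abs_le.1 (hvb z)
    have h2 := abs_le.1 (hvb z')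
    have h3 : 4 * m + 4 ≤ 2 * Λ ^ 2 := by nlinarith
    have h4 : ((4 * m + 4 : ℕ) : ℤ) < (2 ^ B : ℕ) := by exact_mod_cast h3.trans_lt hΛ2
    push_cast at h4
    linarith [h1.1, h2.2]
  obtain ⟨G, hG, hGv⟩ := exists_nn_memorizing_finset (S := S) (B := B) hS (V.image key) v hz hvz
    ((Nat.mul_le_mul_right _ (Finset.card_image_le.trans hVcard)).trans hNS)
  refine ⟨w, fun y => f 0 + W * G y, hG.postcomp (T := fun y => f 0 + W * y) (by fun_prop),
    fun x hx => ?_⟩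
  have h1 := hGv (key (cells q k g x)) (Finset.mem_image_of_mem _ (hV x hx))
  have h2 : (∑ i, (w i : ℝ) * cells q k g x i) = ((key (cells q k g x) : ℤ) : ℝ) := by
    simp [key]
  simp only [h2, h1]
  exact hv _ x hx rfl

/-- The balls of a covering, scaled to boxes `∏ [b i, b i + 1]`. -/
theorem exists_boxes {n : ℕ} {g : ℝ} (hg : 0 < g) {K : Set (Fin n → ℝ)} (hK : K ⊆ cube n) :
    ∃ T : Finset (Fin n → ℝ), T.card ≤ coveringNum (g / 2) K ∧
      ∀ x ∈ K, ∃ b ∈ T, ∀ i, b i ≤ x i / g ∧ x i / g ≤ b i + 1 := by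
  classical
  obtain ⟨c, hc, hcov⟩ := exists_cover (half_pos hg) hK
  refine ⟨c.image fun c i => (c i - g / 2) / g, Finset.card_image_le.trans hc, fun x hx => ?_⟩
  obtain ⟨c₀, hc₀, hxc⟩ := hcov x hx
  refine ⟨_, Finset.mem_image_of_mem _ hc₀, fun i => ?_⟩
  have h1 := abs_le.1 (hxc i)
  constructor
  · gcongr; linarith
  · rw [div_add_one hg.ne']
    gcongr
    linarith

end IntrinsicReLU

/-! ### The networks of prescribed shape -/

namespace IntrinsicReLU

theorem NN.zero {E F : Type} [AddCommGroup E] [Module ℝ E] [AddCommGroup F] [Module ℝ F]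
    (ws : List ℕ) : NN ws (fun _ : E => (0 : F)) := by
  induction ws generalizing E with
  | nil => exact IsAff.const 0
  | cons w ws ih => exact ⟨fun _ => 0, fun _ => 0, IsAff.const 0, ih, fun _ => rfl⟩

theorem NN.reluMap {κ : Type} [Fintype κ] {w : ℕ} (hw : Fintype.card κ ≤ w) :
    NN [w] (reluMap : (κ → ℝ) → κ → ℝ) :=
  NN.layer hw IsAff.id' IsAff.id'

/-- A sum of functions with one hidden layer, computed one after the other. -/
theorem NN.accumulate {ι κ κ' J : Type} [Fintype ι] [Fintype κ] [Fintype κ'] {w : ℕ}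
    (hw : 2 * (Fintype.card ι + Fintype.card κ) + Fintype.card κ' ≤ w)
    {T : J → (ι → ℝ) → κ' → ℝ} (hT : ∀ j, IsAff (T j)) {A : J → (κ' → ℝ) → κ → ℝ}
    (hA : ∀ j, IsAff (A j)) (l : List J) :
    NN (List.replicate l.length w) (fun z : ι ⊕ κ → ℝ => Sum.elim (fun i => z (.inl i))
      (fun k => z (.inr k) +
        (l.map fun j => A j (IntrinsicReLU.reluMap (T j fun i => z (.inl i))) k).sum)) := by
  induction l with
  | nil =>
    refine NN.congr (f := fun z => z) IsAff.id' fun z => ?_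
    ext i
    rcases i with i | i <;> simp
  | cons j l ih =>
    have hstep : NN [w] (fun z : ι ⊕ κ → ℝ => (Sum.elim (fun i => z (.inl i))
        (fun k => z (.inr k) + A j (IntrinsicReLU.reluMap (T j fun i => z (.inl i))) k) :
          ι ⊕ κ → ℝ)) := by
      refine (NN.layer_id (ι := ι ⊕ κ) (κ := κ') (by simpa using hw)
        (T := fun z => T j fun i => z (.inl i)) ((hT j).comp (by fun_prop))
        (A := fun y => Sum.elim (fun i => y.1 (.inl i)) (fun k => y.1 (.inr k) + A j y.2 k)) ?_)
      refine IsAff.pi fun i => ?_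
      rcases i with i | k
      · simp only [Sum.elim_inl]; fun_prop
      · simp only [Sum.elim_inr]
        have : IsAff fun y : (ι ⊕ κ → ℝ) × (κ' → ℝ) => A j y.2 := (hA j).comp (by fun_prop)
        fun_prop
    refine (NN.comp ih hstep).congr fun z => ?_
    ext i
    rcases i with i | k
    · simp
    · simp [add_assoc]

/-- The sum of ramps that counts the grid points passed by `y`. -/
noncomputable def softCell (η : ℝ) (q k m : ℕ) (y : ℝ) : ℝ :=
  ∑ l ∈ Finset.range m, ramp η (y + k - q * (l + 1 : ℕ))

theorem softCell_nonneg (η : ℝ) (q k m : ℕ) (y : ℝ) : 0 ≤ softCell η q k m y :=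
  Finset.sum_nonneg fun _ _ => ramp_nonneg _ _

/-- A functional of the cell numbers in each of several shifted grids, with ramps instead of
jumps. -/
noncomputable def softKeys {n p : ℕ} (η : ℝ) (q m : ℕ) (g : ℝ) (t : Fin p → ℕ)
    (w : Fin p → Fin n → ℕ) (x : Fin n → ℝ) : Fin p → ℝ :=
  fun s => ∑ i, (w s i : ℝ) * softCell η q (t s) m (x i / g)

/-- All functionals of the cell numbers, computed from the point itself. -/
theorem nn_softKeys {n p W : ℕ} (hW : 2 * (n + p) + 2 * n ≤ W) (η : ℝ) (q m : ℕ) (g : ℝ)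
    (t : Fin p → ℕ) (w : Fin p → Fin n → ℕ) :
    NN (List.replicate (p * m) W) (softKeys η q m g t w) := by
  classical
  have h := NN.accumulate (ι := Fin n) (κ := Fin p) (κ' := Fin n ⊕ Fin n) (J := Fin p × Fin m)
    (w := W) (by simp; omega)
    (T := fun j x => Sum.elim (fun i => (x i / g + t j.1 - q * (j.2 + 1 : ℕ)) / η + 1)
      (fun i => (x i / g + t j.1 - q * (j.2 + 1 : ℕ)) / η))
    (fun j => IsAff.pi fun i => by rcases i with i | i <;> simp <;> fun_prop)
    (A := fun j y s => if s = j.1 then ∑ i, (w s i : ℝ) * (y (.inl i) - y (.inr i)) else 0)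
    (fun j => IsAff.pi fun s => by
      by_cases hs : s = j.1
      · simp only [hs, if_true]; fun_prop
      · simp only [hs, if_false]; fun_prop)
    (Finset.univ : Finset (Fin p × Fin m)).toList
  rw [Finset.length_toList, Finset.card_univ, Fintype.card_prod, Fintype.card_fin,
    Fintype.card_fin] at h
  have h' := (h.precomp (T := fun x : Fin n → ℝ => (Sum.elim x fun _ => 0 : Fin n ⊕ Fin p → ℝ))
    (IsAff.pi fun i => by rcases i with i | i <;> simp <;> fun_prop)).postcomp
    (T := fun z s => z (.inr s)) (by fun_prop)
  refine h'.congr fun x => ?_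
  ext s
  simp only [Sum.elim_inl, Sum.elim_inr, zero_add, Finset.sum_map_toList, reluMap]
  rw [Fintype.sum_prod_type, Finset.sum_eq_single s]
  · simp only [if_true, softKeys, softCell, Finset.mul_sum]
    rw [Finset.sum_comm]
    refine (Finset.sum_range fun l =>
      ∑ i, (w s i : ℝ) * ramp η (x i / g + t s - q * (l + 1 : ℕ))).trans ?_
    rfl
  · intro b _ hb
    simp [Ne.symm hb]
  · simp

/-- The cell numbers of a single coordinate in several shifted grids, computed by a network with a
narrow last layer. -/
theorem nn_softCells {n m p : ℕ} (hp : p ≤ 2 * n + 1) (hpm : p ≤ m + 1) (η : ℝ) (q : ℕ) (g : ℝ)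
    (t : Fin p → ℕ) :
    NN (List.replicate 3 (2 * (2 * n + 1) * (m + 1)) ++ [m + 1])
      (fun (y : Fin 1 → ℝ) (j : Fin (2 * n + 1)) =>
      if h : (j : ℕ) < p then softCell η q (t ⟨j, h⟩) m (y 0 / g) else 0) := by
  set W := 2 * (2 * n + 1) * (m + 1)
  have hpW : p ≤ W := by
    calc p ≤ 1 * (2 * n + 1) * 1 := by omega
      _ ≤ W := by simp only [W]; gcongr <;> omega
  have l₁ : NN [W] (fun (y : Fin 1 → ℝ) (s : Fin p) => softCell η q (t s) m (y 0 / g)) := by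
    refine (NN.layer (κ := (Fin p × Fin m) ⊕ (Fin p × Fin m)) ?_
      (T := fun y => Sum.elim (fun j => (y 0 / g + t j.1 - q * (j.2 + 1 : ℕ)) / η + 1)
        (fun j => (y 0 / g + t j.1 - q * (j.2 + 1 : ℕ)) / η))
      (IsAff.pi fun i => by rcases i with i | i <;> simp <;> fun_prop)
      (A := fun z s => ∑ l, (z (.inl (s, l)) - z (.inr (s, l)))) (by fun_prop)).congr fun y => ?_
    · simp only [Fintype.card_sum, Fintype.card_prod, Fintype.card_fin]
      calc p * m + p * m ≤ (2 * n + 1) * (m + 1) + (2 * n + 1) * (m + 1) := by gcongr <;> omega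
        _ = W := by simp only [W]; ring
    · ext s
      simp only [softCell, Finset.sum_range]
      rfl
  have l₂ : NN [W] (reluMap : (Fin p → ℝ) → Fin p → ℝ) := NN.reluMap (by simpa using hpW)
  have l₃ : NN [m + 1] (reluMap : (Fin p → ℝ) → Fin p → ℝ) := NN.reluMap (by simpa using hpm)
  have h := (l₃.comp (l₂.comp (l₂.comp l₁))).postcomp
    (T := fun (z : Fin p → ℝ) (j : Fin (2 * n + 1)) => if h : (j : ℕ) < p then z ⟨j, h⟩ else 0)
    (IsAff.pi fun j => by
      by_cases h : (j : ℕ) < p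
      · simp only [h, dif_pos]; fun_prop
      · simp only [h, dif_neg, not_false_iff]; fun_prop)
  refine NN.congr h fun y => ?_
  ext j
  split_ifs with hj
  · simp [reluMap, relu, max_eq_left (softCell_nonneg _ _ _ _ _)]
  · rfl

/-- A network that copies its input, if that is nonnegative. -/
theorem nn_pass {n m : ℕ} :
    NN (List.replicate 3 (2 * (2 * n + 1) * (m + 1)) ++ [m + 1]) (fun (y : Fin 1 → ℝ)
      (_ : Fin (2 * n + 1)) => relu (y 0)) := by
  set W := 2 * (2 * n + 1) * (m + 1)
  have hW : 1 ≤ W := Nat.mul_pos (by omega) (by omega)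
  have l₂ : NN [W] (reluMap : (Fin 1 → ℝ) → Fin 1 → ℝ) := NN.reluMap (by simpa using hW)
  have l₃ : NN [m + 1] (reluMap : (Fin 1 → ℝ) → Fin 1 → ℝ) := NN.reluMap (by simp)
  refine NN.congr ((l₃.comp (l₂.comp (l₂.comp l₂))).postcomp
    (T := fun (z : Fin 1 → ℝ) (_ : Fin (2 * n + 1)) => z 0) (by fun_prop)) fun y => ?_
  ext j
  simp [reluMap, relu]

theorem exists_pos_forall_le {α : Type} (s : Finset α) (f : α → ℝ) (h : ∀ a ∈ s, 0 < f a) :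
    ∃ η > 0, ∀ a ∈ s, η ≤ f a := by
  rcases s.eq_empty_or_nonempty with rfl | hs
  · exact ⟨1, one_pos, by simp⟩
  · obtain ⟨a, ha, hmin⟩ := s.exists_min_image f hs
    exact ⟨f a, h a ha, hmin⟩

end IntrinsicReLU

/-! ### Counting layers -/

namespace IntrinsicReLU

theorem add_one_pow_four_le (l : ℕ) : (l + 1) ^ 4 ≤ 41 * 2 ^ l := by
  rcases Nat.lt_or_ge l 5 with h | h
  · interval_cases l <;> norm_num
  · induction l, h using Nat.le_induction with
    | base => norm_num
    | succ l hl ih =>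
      have : (l + 1 + 1) ^ 4 ≤ 2 * (l + 1) ^ 4 := by
        have h1 : 6 * (l + 2) ≤ 7 * (l + 1) := by omega
        have h2 := Nat.pow_le_pow_left h1 4
        rw [mul_pow, mul_pow] at h2
        norm_num at h2
        rw [show l + 1 + 1 = l + 2 from rfl]
        omega
      rw [pow_succ 2]
      omega

/-- The squared number of channels is of lower order. -/
theorem channels_sq_le {N a : ℕ} (hN : 1 ≤ N) (ha : a ≤ 6 * (Nat.log 2 N + 1)) :
    ((2 * a + 1 : ℕ) : ℝ) ^ 2 ≤ 1183 * √(N : ℝ) := by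
  set l := Nat.log 2 N
  have h1 : ((2 * a + 1 : ℕ) : ℝ) ≤ 13 * (l + 1) := by
    have : 2 * a + 1 ≤ 13 * (l + 1) := by omega
    exact_mod_cast this
  have h2 : ((l + 1 : ℝ)) ^ 4 ≤ 41 * N := by
    have := (add_one_pow_four_le l).trans
      (Nat.mul_le_mul_left 41 (Nat.pow_log_le_self 2 (by omega)))
    exact_mod_cast this
  have h3 : ((l : ℝ) + 1) ^ 2 ≤ 7 * √(N : ℝ) := by
    refine abs_le_of_sq_le_sq' ?_ (by positivity) |>.2
    rw [mul_pow, Real.sq_sqrt (Nat.cast_nonneg N), ← pow_mul]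
    norm_num
    have : (0 : ℝ) ≤ N := Nat.cast_nonneg N
    linarith
  calc ((2 * a + 1 : ℕ) : ℝ) ^ 2 ≤ (13 * (l + 1)) ^ 2 := by gcongr
    _ = 169 * ((l : ℝ) + 1) ^ 2 := by ring
    _ ≤ 169 * (7 * √(N : ℝ)) := by gcongr
    _ = _ := by ring

/-- The total depth of the keys, the memorizing networks and the median. -/
theorem depth_le {n m N a L₁ L₂ : ℕ} (hn : 1 ≤ n) (hm : 1 ≤ m) (hN : 1 ≤ N)
    (ha : a ≤ 6 * (Nat.log 2 N + 1)) (h1 : L₁ ≤ (2 * a + 1) ^ 2) (h2 : L₂ ≤ (2 * a + 1) ^ 2) :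
    ((L₁ + 12 * (Nat.sqrt (N * (2 * (Nat.log 2 (n * (2 * m + 1) * N) + 1) + 2)) + 1) + L₂ : ℕ) : ℝ)
        ≤
      3000 * √((N : ℝ) * Real.log ((n : ℝ) * (2 * (m : ℝ) + 1) * N)) := by
  set Λ := n * (2 * m + 1) * N with hΛ
  have hcast : (n : ℝ) * (2 * (m : ℝ) + 1) * N = (Λ : ℕ) := by rw [hΛ]; push_cast; ring
  rw [hcast]
  have hΛ3 : 3 ≤ Λ := by
    calc 3 = 1 * (2 * 1 + 1) * 1 := by norm_num
      _ ≤ Λ := by rw [hΛ]; gcongr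
  have hlog1 : (1 : ℝ) ≤ Real.log Λ := by
    rw [Real.le_log_iff_exp_le (by positivity)]
    exact Real.exp_one_lt_d9.le.trans (le_trans (by norm_num) (by exact_mod_cast hΛ3 : (3 : ℝ) ≤ Λ))
  have hN1 : (1 : ℝ) ≤ N := by exact_mod_cast hN
  set s := √((N : ℝ) * Real.log Λ)
  have hs1 : 1 ≤ s := Real.one_le_sqrt.2 (one_le_mul_of_one_le_of_one_le hN1 hlog1)
  have hsN : √(N : ℝ) ≤ s := Real.sqrt_le_sqrt (le_mul_of_one_le_right (by positivity) hlog1)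
  have hb : ((2 * (Nat.log 2 Λ + 1) + 2 : ℕ) : ℝ) ≤ 9 * Real.log Λ := by
    have h3 : (Nat.log 2 Λ : ℝ) * Real.log 2 ≤ Real.log Λ := by
      rw [← Real.log_pow]
      refine Real.log_le_log (by positivity) ?_
      exact_mod_cast Nat.pow_log_le_self 2 (by omega : Λ ≠ 0)
    have h4 := Real.log_two_gt_d9
    have h5 : (0 : ℝ) ≤ Nat.log 2 Λ := Nat.cast_nonneg _
    push_cast
    nlinarith
  have hS : ((Nat.sqrt (N * (2 * (Nat.log 2 Λ + 1) + 2)) : ℕ) : ℝ) ≤ 3 * s := by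
    refine (Real.nat_sqrt_le_real_sqrt).trans ?_
    rw [show (3 : ℝ) * s = √(9 * (N * Real.log Λ)) by
      rw [Real.sqrt_mul (by norm_num), show (9 : ℝ) = 3 ^ 2 by norm_num,
        Real.sqrt_sq (by norm_num)]]
    refine Real.sqrt_le_sqrt ?_
    push_cast at hb ⊢
    nlinarith
  have h6 := channels_sq_le hN ha
  have h7 : (L₁ : ℝ) ≤ ((2 * a + 1 : ℕ) : ℝ) ^ 2 := by exact_mod_cast h1
  have h8 : (L₂ : ℝ) ≤ ((2 * a + 1 : ℕ) : ℝ) ^ 2 := by exact_mod_cast h2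
  push_cast at hS h6 h7 h8 ⊢
  linarith

/-! ### Networks for arbitrary functions -/

/-- The channels for all points of `K`: at every point most of them are accurate. -/
theorem exists_channels {n m : ℕ} (hn : 1 ≤ n) (hm : 1 ≤ m) {f : (Fin n → ℝ) → ℝ} {W : ℝ}
    (hW : 0 ≤ W)
    (hf : ∀ x ∈ cube n, ∀ y ∈ cube n, dist x y ≤ 1 / (2 * (m : ℝ)) → |f x - f y| ≤ W)
    {K : Set (Fin n → ℝ)} (hK : K ⊆ cube n) {N : ℕ}
    (hN : coveringNum (1 / (2 * (m : ℝ) * (2 * (n : ℝ) + 1))) K = N) (hN1 : 1 ≤ N)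
    {S : ℕ} (hS : 0 < S) (hNS : N * (2 * (Nat.log 2 (n * (2 * m + 1) * N) + 1) + 2) ≤ S * S) :
    ∃ (a : ℕ) (t : Fin (2 * a + 1) → ℕ) (w : Fin (2 * a + 1) → Fin n → ℕ) (η g : ℝ)
      (H : Fin (2 * a + 1) → ℝ → ℝ), a ≤ n ∧ a ≤ 6 * (Nat.log 2 N + 1) ∧
      (∀ s, NN (List.replicate (12 * S) 12) (H s)) ∧
      ∀ x ∈ K, ∃ B : Finset (Fin (2 * a + 1)), B.card ≤ a ∧
        ∀ s ∉ B, |f x - H s (softKeys η (3 * n + 1) m g t w x s)| ≤ 2 * W := by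
  classical
  have hm0 : (0 : ℝ) < m := by exact_mod_cast hm
  set g : ℝ := 1 / (m * (2 * n + 1)) with hg
  have hg0 : 0 < g := by positivity
  obtain ⟨T, hT, hbox⟩ := exists_boxes hg0 hK
  rw [show g / 2 = 1 / (2 * (m : ℝ) * (2 * (n : ℝ) + 1)) by rw [hg]; field_simp, hN] at hT
  obtain ⟨η, hη, hηT⟩ := exists_pos_forall_le (T ×ˢ (Finset.univ : Finset (Fin n)))
    (fun bi => 1 - Int.fract (bi.1 bi.2)) (fun bi _ => sub_pos.2 (Int.fract_lt_one _))
  obtain ⟨a, t, han, haN, ht⟩ := exists_shifts (N := N) (by simpa using hT)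
    (fun b : T => Finset.univ.filter fun k : Fin (3 * n + 1) => ¬∀ i, Avoids (3 * n + 1) k (b.1 i))
    (fun b => card_not_avoids_le _ _)
  choose w H hH hHf using fun s => exists_channel hn hm hN1 hS
    (Nat.lt_succ_iff.1 (t s).2) hW hf hg T hT hNS
  refine ⟨a, fun s => t s, w, η, g, H, han, haN, hH, fun x hx => ?_⟩
  obtain ⟨b, hb, hxb⟩ := hbox x hx
  refine ⟨_, ht ⟨b, hb⟩, fun s hs => ?_⟩
  simp only [Finset.mem_filter, Finset.mem_univ, true_and, not_not] at hs
  have hgood : InGoodBox T (3 * n + 1) (t s) g x := ⟨hK hx, b, hb, hxb, hs⟩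
  have h1 := hHf s x hgood
  have h2 : softKeys η (3 * n + 1) m g (fun s => t s) w x s =
      ∑ i, (w s i : ℝ) * cells (3 * n + 1) (t s) g x i := by
    refine Finset.sum_congr rfl fun i _ => ?_
    congr 1
    exact (hs i).sum_ramp_eq (by omega) (hxb i).1 (hxb i).2 hη
      (hηT (b, i) (Finset.mem_product.2 ⟨hb, Finset.mem_univ i⟩))
      (add_lt_of_mem_cube hm (Nat.lt_succ_iff.1 (t s).2) hg (hK hx) i)
  rwa [h2]

/-- The parallel memorizing networks, followed by the median. -/
theorem exists_nn_median_channels {n a L : ℕ} (han : a ≤ n) {H : Fin (2 * a + 1) → ℝ → ℝ}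
    (hH : ∀ s, NN (List.replicate L 12) (H s)) :
    ∃ (M : ℕ) (R : (Fin (2 * a + 1) → ℝ) → ℝ), M ≤ (2 * a + 1) ^ 2 ∧
      NN (List.replicate (L + M) (12 * (2 * n + 1))) R ∧
      ∀ (κ : Fin (2 * a + 1) → ℝ) (y ε : ℝ) (B : Finset (Fin (2 * a + 1))), B.card ≤ a →
        (∀ s ∉ B, |y - H s (κ s)| ≤ ε) → |y - R κ| ≤ ε := by
  obtain ⟨M, F, hM, hF, h⟩ := exists_nn_median a (w := 12 * (2 * n + 1)) (by omega)
  refine ⟨M, fun κ => F fun s => H s (κ s), hM, ?_, fun κ y ε B hB hκ =>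
    abs_sub_le_of_median h B hB hκ⟩
  exact hF.comp_replicate (NN.mono (by omega) (NN.pi hH))

/-- The constant `3000` comes from `depth_le`. If `K` is empty or the modulus is infinite, any
network will do. -/
theorem exists_networks {n m : ℕ} (hn : 1 ≤ n) (hm : 1 ≤ m) (f : (Fin n → ℝ) → ℝ)
    {K : Set (Fin n → ℝ)} (hK : K ⊆ cube n) :
    ∃ (L : ℕ)
      (Φ : ReLUNet 1 (List.replicate 3 (2 * (2 * n + 1) * (m + 1)) ++ [m + 1]) (2 * n + 1))
      (ρ : ReLUNet (n * (2 * n + 1))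
        (List.replicate (3000 * (m + 1)) (3000 * (n + 1)) ++
          List.replicate L (12 * (2 * n + 1))) 1),
      (L : ℝ) ≤ 3000 * √((coveringNum (1 / (2 * (m : ℝ) * (2 * (n : ℝ) + 1))) K : ℝ) *
        Real.log ((n : ℝ) * (2 * (m : ℝ) + 1) *
          (coveringNum (1 / (2 * (m : ℝ) * (2 * (n : ℝ) + 1))) K : ℝ))) ∧
      ∀ x ∈ K, ENNReal.ofReal |f x - ρ.eval (stack Φ x) 0| ≤
        2 * modulus f (1 / (2 * (m : ℝ))) := by
  obtain ⟨N, hN⟩ : ∃ N, coveringNum (1 / (2 * (m : ℝ) * (2 * (n : ℝ) + 1))) K = N := ⟨_, rfl⟩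
  have hm0 : (0 : ℝ) < m := by exact_mod_cast hm
  rw [hN]
  by_cases htriv : N = 0 ∨ modulus f (1 / (2 * (m : ℝ))) = ⊤
  · obtain ⟨Φ, -⟩ := (NN.zero (E := Fin 1 → ℝ) (F := Fin (2 * n + 1) → ℝ)
      (List.replicate 3 (2 * (2 * n + 1) * (m + 1)) ++ [m + 1])).exists_reLUNet
    obtain ⟨ρ, -⟩ := (NN.zero (E := Fin (n * (2 * n + 1)) → ℝ) (F := Fin 1 → ℝ)
      (List.replicate (3000 * (m + 1)) (3000 * (n + 1)) ++
        List.replicate 0 (12 * (2 * n + 1)))).exists_reLUNet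
    refine ⟨0, Φ, ρ, by simp only [Nat.cast_zero]; positivity, fun x hx => ?_⟩
    rcases htriv with h | h
    · obtain ⟨c, hc, hcov⟩ := exists_cover
        (r := 1 / (2 * (m : ℝ) * (2 * (n : ℝ) + 1))) (by positivity) hK
      rw [hN, h, Nat.le_zero, Finset.card_eq_zero] at hc
      obtain ⟨c₀, hc₀, -⟩ := hcov x hx
      simp [hc] at hc₀
    · rw [h]
      exact le_of_le_of_eq le_top (by simp)
  push Not at htriv
  obtain ⟨hN0, htop⟩ := htriv
  have hN1 : 1 ≤ N := Nat.one_le_iff_ne_zero.2 hN0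
  set W := (modulus f (1 / (2 * (m : ℝ)))).toReal with hW
  set S := Nat.sqrt (N * (2 * (Nat.log 2 (n * (2 * m + 1) * N) + 1) + 2)) + 1 with hS
  obtain ⟨a, t, w, η, g, H, han, haN, hH, happ⟩ := exists_channels hn hm
    (ENNReal.toReal_nonneg (a := modulus f (1 / (2 * (m : ℝ)))))
    (fun x hx y hy hxy => abs_sub_le_of_modulus htop hx hy hxy) hK hN hN1 (S := S)
    (Nat.succ_pos _) (Nat.lt_succ_sqrt _).le
  obtain ⟨M, R, hM, hR, hmed⟩ := exists_nn_median_channels han hH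
  have hconv : ∀ {u v : ℝ}, |u - v| ≤ 2 * W →
      ENNReal.ofReal |u - v| ≤ 2 * modulus f (1 / (2 * (m : ℝ))) := by
    intro u v h
    refine (ENNReal.ofReal_le_ofReal h).trans (le_of_eq ?_)
    rw [ENNReal.ofReal_mul (by norm_num), hW, ENNReal.ofReal_toReal htop]
    simp
  rcases le_or_gt (2 * a + 1) (m + 1) with hcase | hcase
  · -- the cell numbers pass through the narrow layer
    obtain ⟨Φ, hΦ⟩ := (nn_softCells (n := n) (by omega) hcase η (3 * n + 1) g t).exists_reLUNet
    have h1 : NN (List.replicate (3000 * (m + 1)) (3000 * (n + 1)))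
        (fun κ : Fin (2 * a + 1) → ℝ => κ) := NN.id _ (by simp; omega)
    have h2 := (hR.comp h1).precomp (T := fun (Y : Fin (n * (2 * n + 1)) → ℝ) s =>
      ∑ i, (w s i : ℝ) * Y (finProdFinEquiv (i, Fin.castLE (by omega) s))) (by fun_prop)
    obtain ⟨ρ, hρ⟩ := (h2.postcomp (T := fun y (_ : Fin 1) => y) (by fun_prop)).exists_reLUNet
    refine ⟨12 * S + M, Φ, ρ, ?_, fun x hx => hconv ?_⟩
    · have := depth_le (L₁ := 0) hn hm hN1 haN (Nat.zero_le _) hM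
      rw [← hS, Nat.zero_add] at this
      exact this
    · obtain ⟨B, hB, hxB⟩ := happ x hx
      rw [hρ]
      refine hmed _ _ _ B hB fun s hs => ?_
      convert hxB s hs using 4
      refine Finset.sum_congr rfl fun i _ => ?_
      simp only [stack, hΦ, Equiv.symm_apply_apply, Fin.val_castLE, s.2, dif_pos]
  · -- the coordinates themselves pass through the narrow layer
    obtain ⟨Φ, hΦ⟩ := (nn_pass (n := n) (m := m)).exists_reLUNet
    have h1 : NN (List.replicate (3000 * (m + 1)) (3000 * (n + 1)))
        (fun κ : Fin n → ℝ => κ) := NN.id _ (by simp; omega)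
    have h2 : NN (List.replicate ((2 * a + 1) * m) (12 * (2 * n + 1)))
        (softKeys η (3 * n + 1) m g t w) :=
      nn_softKeys (by omega) η (3 * n + 1) m g t w
    have h3 := ((hR.comp_replicate h2).comp h1).precomp
      (T := fun (Y : Fin (n * (2 * n + 1)) → ℝ) i => Y (finProdFinEquiv (i, 0))) (by fun_prop)
    obtain ⟨ρ, hρ⟩ := (h3.postcomp (T := fun y (_ : Fin 1) => y) (by fun_prop)).exists_reLUNet
    refine ⟨(2 * a + 1) * m + (12 * S + M), Φ, ρ, ?_, fun x hx => hconv ?_⟩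
    · have := depth_le (L₁ := (2 * a + 1) * m) hn hm hN1 haN (by nlinarith) hM
      rwa [← hS, add_assoc] at this
    · obtain ⟨B, hB, hxB⟩ := happ x hx
      rw [hρ]
      refine hmed _ _ _ B hB fun s hs => ?_
      convert hxB s hs using 5
      ext i
      simpa [stack, hΦ, relu] using (hK hx).1 i

end IntrinsicReLU

/-! ### Keys along a space-filling order -/

namespace IntrinsicReLU

/-- The number whose binary digits are `b i % 2`. -/
def bitVal {n : ℕ} (b : Fin n → ℕ) : ℕ := ∑ i : Fin n, 2 ^ (i : ℕ) * (b i % 2)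

theorem bitVal_eq {n : ℕ} (b : Fin n → ℕ) :
    bitVal b = finFunctionFinEquiv fun i => (⟨b i % 2, Nat.mod_lt _ two_pos⟩ : Fin 2) := by
  rw [finFunctionFinEquiv_apply, bitVal]
  exact Finset.sum_congr rfl fun i _ => mul_comm _ _

theorem bitVal_lt {n : ℕ} (b : Fin n → ℕ) : bitVal b < 2 ^ n := by
  rw [bitVal_eq]; exact Fin.is_lt _

theorem bitVal_inj {n : ℕ} {b b' : Fin n → ℕ} (h : bitVal b = bitVal b') (i : Fin n) :
    b i % 2 = b' i % 2 := by
  rw [bitVal_eq, bitVal_eq] at h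
  have := congrFun (finFunctionFinEquiv.injective (Fin.ext h)) i
  exact congrArg Fin.val this

/-- The interleaved binary digits of the coordinates of `c`, up to level `J`. Cells in a common
dyadic block of side `2 ^ t` are those whose keys agree from the digit `n t` on. -/
def morton {n : ℕ} (J : ℕ) (c : Fin n → ℕ) : ℕ :=
  ∑ t ∈ Finset.range J, 2 ^ (n * t) * bitVal fun i => c i / 2 ^ t

theorem morton_succ {n : ℕ} (J : ℕ) (c : Fin n → ℕ) :
    morton (J + 1) c = 2 ^ n * morton J (fun i => c i / 2) + bitVal c := by
  simp only [morton, Finset.sum_range_succ', Finset.mul_sum]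
  congr 1
  · refine Finset.sum_congr rfl fun t _ => ?_
    rw [mul_add, mul_one, pow_add, ← mul_assoc, mul_comm (2 ^ n)]
    simp only [Nat.div_div_eq_div_mul, pow_succ']
  · simp

theorem morton_div {n : ℕ} (J t : ℕ) (c : Fin n → ℕ) :
    morton (J + t) c / 2 ^ (n * t) = morton J fun i => c i / 2 ^ t := by
  induction t generalizing c with
  | zero => simp
  | succ t ih =>
    rw [← add_assoc, morton_succ, mul_add, mul_one, add_comm (n * t), pow_add,
      ← Nat.div_div_eq_div_mul, Nat.mul_add_div (Nat.two_pow_pos n),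
      Nat.div_eq_of_lt (bitVal_lt c), add_zero, ih]
    simp only [Nat.div_div_eq_div_mul, pow_succ']

theorem morton_inj {n J : ℕ} {c c' : Fin n → ℕ} (hc : ∀ i, c i < 2 ^ J) (hc' : ∀ i, c' i < 2 ^ J)
    (h : morton J c = morton J c') : c = c' := by
  induction J generalizing c c' with
  | zero =>
    ext i
    have := hc i
    have := hc' i
    simp at *
    omega
  | succ J ih =>
    rw [morton_succ, morton_succ] at h
    have h1 := congrArg (· % 2 ^ n) h
    have h2 := congrArg (· / 2 ^ n) h
    simp only [Nat.mul_add_mod, Nat.mod_eq_of_lt (bitVal_lt _)] at h1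
    simp only [Nat.mul_add_div (Nat.two_pow_pos n), Nat.div_eq_of_lt (bitVal_lt _), add_zero] at h2
    have h3 := ih (fun i => Nat.div_lt_of_lt_mul (by rw [← pow_succ']; exact hc i))
      (fun i => Nat.div_lt_of_lt_mul (by rw [← pow_succ']; exact hc' i)) h2
    ext i
    have h4 := congrFun h3 i
    have h5 := bitVal_inj h1 i
    omega

theorem morton_lt {n : ℕ} (J : ℕ) (c : Fin n → ℕ) : morton J c < 2 ^ (n * J) := by
  rw [← Nat.div_eq_zero_iff_lt (Nat.two_pow_pos _)]
  have := morton_div 0 J c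
  rw [zero_add] at this
  rw [this]
  rfl

theorem morton_block {n J t : ℕ} (ht : t ≤ J) {c c' : Fin n → ℕ} (hc : ∀ i, c i < 2 ^ J)
    (hc' : ∀ i, c' i < 2 ^ J) (h : morton J c / 2 ^ (n * t) = morton J c' / 2 ^ (n * t))
    (i : Fin n) :
    c i / 2 ^ t = c' i / 2 ^ t := by
  obtain ⟨J, rfl⟩ := Nat.exists_eq_add_of_le' ht
  rw [morton_div, morton_div] at h
  have hlt : ∀ {c : Fin n → ℕ}, (∀ i, c i < 2 ^ (J + t)) → ∀ i, c i / 2 ^ t < 2 ^ J := by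
    intro c hc i
    refine Nat.div_lt_of_lt_mul ?_
    rw [← pow_add, add_comm]
    exact hc i
  exact congrFun (morton_inj (hlt hc) (hlt hc') h) i

/-- Extract one binary digit of every coordinate, and add the digits to the key. -/
noncomputable def bitStep {n : ℕ} (η : ℝ) (q t : ℕ) (s : Fin n ⊕ Unit → ℝ) : Fin n ⊕ Unit → ℝ :=
  Sum.elim (fun i => s (.inl i) - q * 2 ^ t * ramp η (s (.inl i) - q * 2 ^ t))
    (fun u => s (.inr u) + 2 ^ (n * t) * ∑ i : Fin n, 2 ^ (i : ℕ) * ramp η (s (.inl i) - q * 2 ^ t))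

/-- Extract `J` binary digits, the leading ones first. -/
noncomputable def bitRun {n : ℕ} (η : ℝ) (q : ℕ) : ℕ → (Fin n ⊕ Unit → ℝ) → Fin n ⊕ Unit → ℝ
  | 0, s => s
  | t + 1, s => bitRun η q t (bitStep η q t s)

theorem nn_bitStep {n W : ℕ} (hW : 4 * n + 2 ≤ W) (η : ℝ) (q t : ℕ) :
    NN [W] (bitStep (n := n) η q t) := by
  refine (NN.layer_id (ι := Fin n ⊕ Unit) (κ := Fin n ⊕ Fin n) (by simp; omega)
    (T := fun s => Sum.elim (fun i => (s (.inl i) - q * 2 ^ t) / η + 1)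
      (fun i => (s (.inl i) - q * 2 ^ t) / η))
    (IsAff.pi fun i => by rcases i with i | i <;> simp <;> fun_prop)
    (A := fun y => Sum.elim
      (fun i => y.1 (.inl i) - q * 2 ^ t * (y.2 (.inl i) - y.2 (.inr i)))
      (fun u => y.1 (.inr u) +
        2 ^ (n * t) * ∑ i : Fin n, 2 ^ (i : ℕ) * (y.2 (.inl i) - y.2 (.inr i))))
    (IsAff.pi fun i => by
      rcases i with i | i <;> simp only [Sum.elim_inl, Sum.elim_inr] <;> fun_prop)).congr
    fun s => rfl

theorem nn_bitRun {n W : ℕ} (hW : 4 * n + 2 ≤ W) (η : ℝ) (q J : ℕ) :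
    NN (List.replicate J W) (bitRun (n := n) η q J) := by
  induction J with
  | zero => exact IsAff.id'
  | succ J ih => exact NN.comp (ws := [W]) ih (nn_bitStep hW η q J)

theorem bitRun_eq {n q k : ℕ} {b y : Fin n → ℝ} (h : ∀ i, Avoids q k (b i))
    (h1 : ∀ i, b i ≤ y i) (h2 : ∀ i, y i ≤ b i + 1) (hy : ∀ i, 0 ≤ y i) {η : ℝ} (hη : 0 < η)
    (hηb : ∀ i, η ≤ 1 - Int.fract (b i)) (hq : 0 < q) (t : ℕ) (κ : ℝ) :
    bitRun η q t (Sum.elim (fun i => y i + k - q * (2 ^ t * (cell q k (y i) / 2 ^ t) : ℕ))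
      fun _ => κ) (.inr ()) = κ + morton t fun i => cell q k (y i) := by
  induction t generalizing κ with
  | zero => simp [bitRun, morton]
  | succ t ih =>
    have hq' : (0 : ℝ) < q := by exact_mod_cast hq
    have hb : ∀ i, ramp η (y i + k - q * (2 ^ (t + 1) * (cell q k (y i) / 2 ^ (t + 1)) : ℕ) -
        q * 2 ^ t) = (cell q k (y i) / 2 ^ t % 2 : ℕ) := by
      intro i
      set c := cell q k (y i) with hc
      have e := (h i).ramp_eq (h1 i) (h2 i) hη (hηb i) (2 ^ t * (2 * (c / 2 ^ (t + 1)) + 1))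
      rw [show y i + k - q * (2 ^ (t + 1) * (c / 2 ^ (t + 1)) : ℕ) - q * 2 ^ t =
        y i + k - q * (2 ^ t * (2 * (c / 2 ^ (t + 1)) + 1) : ℕ) by push_cast; ring, e]
      have e2 : (q * (2 ^ t * (2 * (c / 2 ^ (t + 1)) + 1) : ℕ) : ℝ) ≤ y i + k ↔
          c / 2 ^ t % 2 = 1 := by
        rw [mul_comm, ← le_div_iff₀ hq', ← Nat.le_floor_iff (div_nonneg (add_nonneg (hy i)
          (Nat.cast_nonneg k)) hq'.le)]
        change 2 ^ t * (2 * (c / 2 ^ (t + 1)) + 1) ≤ c ↔ _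
        rw [mul_comm, ← Nat.le_div_iff_mul_le (Nat.two_pow_pos t), pow_succ,
          ← Nat.div_div_eq_div_mul]
        omega
      rcases Nat.mod_two_eq_zero_or_one (c / 2 ^ t) with h0 | h0
      · rw [if_neg (by rw [e2]; omega), h0]; simp
      · rw [if_pos (by rw [e2]; exact h0), h0]; simp
    have hstep : bitStep η q t (Sum.elim
        (fun i => y i + k - q * (2 ^ (t + 1) * (cell q k (y i) / 2 ^ (t + 1)) : ℕ)) fun _ => κ) =
        Sum.elim (fun i => y i + k - q * (2 ^ t * (cell q k (y i) / 2 ^ t) : ℕ))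
          fun _ => κ + (2 ^ (n * t) * bitVal fun i => cell q k (y i) / 2 ^ t : ℕ) := by
      ext i
      rcases i with i | u
      · simp only [bitStep, Sum.elim_inl, hb]
        have e3 : 2 ^ (t + 1) * (cell q k (y i) / 2 ^ (t + 1)) +
            2 ^ t * (cell q k (y i) / 2 ^ t % 2) =
            2 ^ t * (cell q k (y i) / 2 ^ t) := by
          rw [pow_succ, ← Nat.div_div_eq_div_mul, mul_assoc, ← mul_add, Nat.div_add_mod]
        rw [← e3]
        push_cast
        ring
      · simp only [bitStep, Sum.elim_inl, Sum.elim_inr, hb, bitVal]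
        push_cast
        rfl
    rw [bitRun, hstep, ih]
    simp only [morton, Finset.sum_range_succ]
    push_cast
    ring

end IntrinsicReLU

/-! ### Hölder functions on sets of small covering numbers -/

namespace IntrinsicReLU

theorem euclNorm_le {n : ℕ} (x : Fin n → ℝ) : euclNorm x ≤ n * ‖x‖ := by
  rw [euclNorm, EuclideanSpace.norm_eq]
  refine Real.sqrt_le_iff.2 ⟨by positivity, ?_⟩
  calc ∑ i, ‖(WithLp.toLp 2 x : EuclideanSpace ℝ (Fin n)) i‖ ^ 2 ≤ ∑ _i : Fin n, ‖x‖ ^ 2 :=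
        Finset.sum_le_sum fun i _ => pow_le_pow_left₀ (norm_nonneg _) (norm_le_pi_norm x i) 2
    _ = n * ‖x‖ ^ 2 := by simp
    _ ≤ (n * ‖x‖) ^ 2 := by
      rw [mul_pow]
      refine mul_le_mul_of_nonneg_right ?_ (sq_nonneg _)
      exact_mod_cast Nat.le_self_pow (by norm_num) n

theorem abs_sub_le_of_holder {n : ℕ} {α : ℝ} (hα : 0 < α) {f : (Fin n → ℝ) → ℝ}
    (hf : holderSeminorm α f ≤ 1) {x y : Fin n → ℝ} (hx : x ∈ cube n) (hy : y ∈ cube n) {D : ℝ}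
    (hxy : dist x y ≤ D) : |f x - f y| ≤ (n * D) ^ α := by
  have hD : 0 ≤ D := dist_nonneg.trans hxy
  by_cases hne : x = y
  · rw [hne, sub_self, abs_zero]; positivity
  have h1 : ENNReal.ofReal (|f x - f y| / euclNorm (x - y) ^ α) ≤ 1 :=
    le_trans (le_iSup₂_of_le x hx (le_iSup₂_of_le y hy (le_iSup (fun _ : x ≠ y =>
      ENNReal.ofReal (|f x - f y| / euclNorm (x - y) ^ α)) hne))) hf
  have h2 : 0 < euclNorm (x - y) := by
    rw [euclNorm, norm_pos_iff]
    simpa [sub_eq_zero] using hne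
  rw [ENNReal.ofReal_le_one, div_le_one (Real.rpow_pos_of_pos h2 α)] at h1
  refine h1.trans (Real.rpow_le_rpow h2.le ((euclNorm_le _).trans ?_) hα.le)
  rw [← dist_eq_norm]
  gcongr

/-- In an increasing list the number of consecutive pairs in different blocks is less than the
number of blocks; summed over all levels this bounds the cost. -/
theorem chainCost_le {b : ℕ → ℤ} (hb : ∀ s, 0 < b s) (J n : ℕ) (l : List ℤ)
    (hl : l.Pairwise (· < ·)) :
    Tape.chainCost
        (fun z z' => n * ((Finset.range J).filter fun s => z / b s ≠ z' / b s).card + 3) l ≤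
      3 * l.length + n * ∑ s ∈ Finset.range J, (l.toFinset.image (· / b s)).card := by
  induction l with
  | nil => simp [Tape.chainCost]
  | cons a l ih =>
    cases l with
    | nil => simp [Tape.chainCost]
    | cons a' l =>
      rw [List.pairwise_cons] at hl
      have ih := ih hl.2
      have key : ((Finset.range J).filter fun s => a / b s ≠ a' / b s).card +
          ∑ s ∈ Finset.range J, ((a' :: l).toFinset.image (· / b s)).card ≤
            ∑ s ∈ Finset.range J, ((a :: a' :: l).toFinset.image (· / b s)).card := by
        rw [Finset.card_filter, ← Finset.sum_add_distrib]
        refine Finset.sum_le_sum fun s _ => ?_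
        rw [List.toFinset_cons (a := a), Finset.image_insert]
        split_ifs with h
        · rw [Finset.card_insert_of_notMem, add_comm]
          intro hmem
          obtain ⟨y, hy, hya⟩ := Finset.mem_image.1 hmem
          have h1 : a' ≤ y := by
            rcases List.mem_cons.1 (List.mem_toFinset.1 hy) with rfl | hy
            · exact le_rfl
            · exact ((List.pairwise_cons.1 hl.2).1 y hy).le
          have h2 := Int.ediv_le_ediv (hb s) h1
          have h3 := Int.ediv_le_ediv (hb s) (hl.1 a' List.mem_cons_self).le
          have hya : y / b s = a / b s := hya
          omega
        · rw [zero_add]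
          exact Finset.card_le_card (Finset.subset_insert _ _)
      have := Nat.mul_le_mul_left n key
      simp only [Tape.chainCost, List.length_cons, mul_add] at ih this ⊢
      omega

/-- The points of `K` meet few blocks of `2 ^ s` cells in each direction. -/
theorem exists_blocks {n : ℕ} {K : Set (Fin n → ℝ)} (hK : K ⊆ cube n) {q : ℕ} (hq : 0 < q) (k : ℕ)
    {g : ℝ} (hg : 0 < g) (s : ℕ) :
    ∃ B : Finset (Fin n → ℕ), B.card ≤ 2 ^ n * coveringNum (g * 2 ^ s / 2) K ∧
      ∀ x ∈ K, (fun i => cells q k g x i / 2 ^ s) ∈ B := by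
  classical
  obtain ⟨T, hT, hcov⟩ := exists_cover (r := g * 2 ^ s / 2) (by positivity) hK
  let β : (Fin n → ℝ) → Fin n → ℝ := fun c i => ((c i - g * 2 ^ s / 2) / g + k) / (q * 2 ^ s)
  refine ⟨T.biUnion fun c => Fintype.piFinset fun i => {⌊β c i⌋₊, ⌊β c i⌋₊ + 1}, ?_, fun x hx => ?_⟩
  · refine (Finset.card_biUnion_le_card_mul T _ (2 ^ n) fun c _ => ?_).trans ?_
    · rw [Fintype.card_piFinset]
      exact (Finset.prod_le_prod' fun i _ => Finset.card_le_two).trans (by simp)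
    · rw [mul_comm]; gcongr
  · obtain ⟨c, hc, hxc⟩ := hcov x hx
    refine Finset.mem_biUnion.2 ⟨c, hc, Fintype.mem_piFinset.2 fun i => ?_⟩
    have hq' : (1 : ℝ) ≤ q := by exact_mod_cast hq
    have h2s : (0 : ℝ) < 2 ^ s := by positivity
    have h1 := abs_le.1 (hxc i)
    set u := (x i / g + k) / (q * 2 ^ s) with hu
    have e : cells q k g x i / 2 ^ s = ⌊u⌋₊ := by
      rw [cells, cell, hu, ← div_div]
      have := Nat.floor_div_natCast ((x i / g + k) / q) (2 ^ s)
      push_cast at this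
      exact this.symm
    have h2 : β c i ≤ u := by
      simp only [β, hu]
      gcongr
      linarith
    have h3 : u ≤ β c i + 1 := by
      simp only [β, hu]
      rw [div_add_one (by positivity)]
      have h4 : x i / g ≤ (c i - g * 2 ^ s / 2) / g + 2 ^ s := by
        rw [div_add' _ _ _ hg.ne']
        gcongr
        linarith
      refine div_le_div_of_nonneg_right ?_ (by positivity)
      nlinarith
    have h5 : ⌊β c i⌋₊ ≤ ⌊u⌋₊ := Nat.floor_mono h2
    have h6 : ⌊u⌋₊ ≤ ⌊β c i⌋₊ + 1 := by
      rcases le_or_gt 0 (β c i) with h | h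
      · rw [← Nat.floor_add_one h]; exact Nat.floor_mono h3
      · have : ⌊u⌋₊ < 1 := (Nat.floor_lt' one_ne_zero).2 (by push_cast; linarith)
        omega
    simp only [e, Finset.mem_insert, Finset.mem_singleton]
    omega

/-- One channel: the keys are the interleaved digits of the cell numbers. Neighbouring keys in a
common block of `2 ^ t` cells differ by less than `2 ^ (n t)`, and their values by `O (2 ^ t)`
quanta, so that the cost of a key is proportional to the number of levels on which a new block
begins. -/
theorem exists_holder_channel {n q k J S : ℕ} (hn : 1 ≤ n) (hq : 0 < q) (hJ : 1 ≤ J) (hS : 0 < S)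
    {α ε g : ℝ} (hα : 0 < α) (hα1 : α ≤ 1) (hε : 0 < ε) (hg : 0 < g)
    (hgε : n * (q * g) = ε ^ (1 / α)) {f : (Fin n → ℝ) → ℝ} (hf : holderSeminorm α f ≤ 1)
    {K : Set (Fin n → ℝ)} (hK : K ⊆ cube n)
    (T : Finset (Fin n → ℝ)) (hJk : 1 / g + k < q * 2 ^ J)
    (hNS : (n + 3) * ∑ s ∈ Finset.range J, 2 ^ n * coveringNum (g * 2 ^ s / 2) K ≤ S * S) :
    ∃ H : ℝ → ℝ, NN (List.replicate (12 * S) 12) H ∧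
      ∀ x ∈ K, InGoodBox T q k g x → |f x - H (morton J (cells q k g x))| ≤ ε := by
  classical
  have hlt : ∀ x ∈ cube n, ∀ i, cells q k g x i < 2 ^ J := by
    intro x hx i
    refine (Nat.floor_lt' (Nat.two_pow_pos J).ne').2 ?_
    rw [div_lt_iff₀ (by exact_mod_cast hq)]
    have : x i / g ≤ 1 / g := div_le_div_of_nonneg_right (hx.2 i) hg.le
    push_cast
    linarith
  -- on a block of `2 ^ t` cells in each direction `f` oscillates by `(2 ^ t) ^ α * ε ≤ 2 ^ t * ε`
  have hosc : ∀ x ∈ cube n, ∀ y ∈ cube n, ∀ t : ℕ,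
      (∀ i, cells q k g x i / 2 ^ t = cells q k g y i / 2 ^ t) → |f x - f y| ≤ ε * 2 ^ t := by
    intro x hx y hy t hxy
    refine (abs_sub_le_of_holder hα hf hx hy (dist_le_of_cells hq hg hx hy hxy)).trans ?_
    rw [← mul_assoc, hgε, Real.mul_rpow (by positivity) (by positivity), ← Real.rpow_mul hε.le,
      one_div_mul_cancel hα.ne', Real.rpow_one]
    refine mul_le_mul_of_nonneg_left ?_ hε.le
    calc ((2 : ℝ) ^ t) ^ α ≤ ((2 : ℝ) ^ t) ^ (1 : ℝ) :=
          Real.rpow_le_rpow_of_exponent_le (one_le_pow₀ one_le_two) hα1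
      _ = 2 ^ t := Real.rpow_one _
  let key : (Fin n → ℝ) → ℤ := fun x => (morton J (cells q k g x) : ℕ)
  have hkeyinj : ∀ x ∈ cube n, ∀ y ∈ cube n, key x = key y → cells q k g x = cells q k g y :=
    fun x hx y hy h => morton_inj (hlt x hx) (hlt y hy) (Int.natCast_inj.1 h)
  have hlab : ∀ z : ℤ, ∃ v : ℤ, ∀ x, x ∈ cube n → key x = z → |f x - ε * v| ≤ ε := by
    intro z
    obtain ⟨v, hv⟩ := exists_label f {x | x ∈ cube n ∧ key x = z} (s := ε) hε (by
      rintro x ⟨hx, hxz⟩ y ⟨hy, hyz⟩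
      have h1 := hkeyinj x hx y hy (hxz.trans hyz.symm)
      simpa using hosc x hx y hy 0 fun i => by rw [h1])
    exact ⟨v, fun x hx hxz => (hv x ⟨hx, hxz⟩).trans (by linarith)⟩
  choose v hv using hlab
  obtain ⟨Z, hZ⟩ : ∃ Z : Finset ℤ, ∀ z, z ∈ Z ↔ ∃ x ∈ K, InGoodBox T q k g x ∧ key x = z := by
    have hfin : {z | ∃ x ∈ K, InGoodBox T q k g x ∧ key x = z}.Finite := by
      refine (T.finite_toSet.image fun b => ((morton J fun i => cell q k (b i) : ℕ) : ℤ)).subset ?_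
      rintro z ⟨x, hx, hgx, rfl⟩
      obtain ⟨b, hb, hbx⟩ := hgx.exists_box hq
      exact ⟨b, hb, by simp only [key, hbx]⟩
    exact ⟨hfin.toFinset, fun z => by simp⟩
  let lev : ℤ → ℤ → ℕ := fun z z' =>
    ((Finset.range J).filter fun s => z / 2 ^ (n * s) ≠ z' / 2 ^ (n * s)).card
  have hdiv : ∀ x (s : ℕ), key x / 2 ^ (n * s) = (morton J (cells q k g x) / 2 ^ (n * s) : ℕ) := by
    intro x s; simp [key]
  have hlev : ∀ x ∈ cube n, ∀ y ∈ cube n, lev (key x) (key y) ≤ J ∧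
      morton J (cells q k g x) / 2 ^ (n * lev (key x) (key y)) =
        morton J (cells q k g y) / 2 ^ (n * lev (key x) (key y)) := by
    intro x hx y hy
    set t := lev (key x) (key y) with ht
    have htJ : t ≤ J := (Finset.card_filter_le _ _).trans (by simp)
    refine ⟨htJ, ?_⟩
    rcases htJ.eq_or_lt with h | h
    · rw [h, Nat.div_eq_of_lt (morton_lt J _), Nat.div_eq_of_lt (morton_lt J _)]
    by_contra hne
    have hsub : Finset.range (t + 1) ⊆
        (Finset.range J).filter fun s => key x / 2 ^ (n * s) ≠ key y / 2 ^ (n * s) := by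
      intro s hs
      have hst : s ≤ t := Nat.lt_succ_iff.1 (Finset.mem_range.1 hs)
      refine Finset.mem_filter.2 ⟨Finset.mem_range.2 (by omega), fun heq => hne ?_⟩
      rw [hdiv, hdiv, Int.natCast_inj] at heq
      obtain ⟨r, hr⟩ := Nat.exists_eq_add_of_le hst
      rw [hr, mul_add, pow_add, ← Nat.div_div_eq_div_mul, ← Nat.div_div_eq_div_mul, heq]
    have := Finset.card_le_card hsub
    rw [Finset.card_range] at this
    exact absurd this (by rw [not_le, Nat.lt_succ_iff, ht])
  have hfits : Z.sort.IsChain (Tape.PairFits v fun z z' => n * lev z z' + 2) := by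
    refine List.Pairwise.isChain ?_
    refine (Z.sortedLT_sort.pairwise).imp_of_mem fun {z z'} h1 h2 h12 => ?_
    rw [Finset.mem_sort, hZ] at h1 h2
    obtain ⟨x, hxK, hx, rfl⟩ := h1
    obtain ⟨y, hyK, hy, rfl⟩ := h2
    obtain ⟨htJ, ht⟩ := hlev x hx.1 y hy.1
    set t := lev (key x) (key y)
    have h2t : (2 : ℤ) ^ t ≤ 2 ^ (n * t) :=
      pow_le_pow_right₀ (by norm_num) (Nat.le_mul_of_pos_left t hn)
    have h1t : (1 : ℤ) ≤ 2 ^ t := one_le_pow₀ (by norm_num)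
    have hval : |v (key y) - v (key x)| ≤ 2 + 2 ^ t := by
      have e1 := abs_le.1 (hv _ x hx.1 rfl)
      have e2 := abs_le.1 (hv _ y hy.1 rfl)
      have e3 := abs_le.1 (hosc x hx.1 y hy.1 t (morton_block htJ (hlt x hx.1) (hlt y hy.1) ht))
      have h3 : ((v (key y) : ℝ) - v (key x)) ≤ 2 + 2 ^ t := by
        refine le_of_mul_le_mul_left ?_ hε
        linarith [e1.1, e2.2, e3.1]
      have h4 : -(2 + 2 ^ t) ≤ ((v (key y) : ℝ) - v (key x)) := by
        refine le_of_mul_le_mul_left ?_ hε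
        linarith [e1.2, e2.1, e3.2]
      rw [abs_le]
      exact ⟨by exact_mod_cast h4, by exact_mod_cast h3⟩
    have hpow : (2 : ℤ) ^ (n * t + 2) = 4 * 2 ^ (n * t) := by rw [pow_add]; ring
    have hval' := abs_le.1 hval
    refine ⟨h12, ?_, by rw [hpow]; linarith [hval'.1], by rw [hpow]; linarith [hval'.2]⟩
    have e1 := Nat.div_add_mod (morton J (cells q k g x)) (2 ^ (n * t))
    have e2 := Nat.div_add_mod (morton J (cells q k g y)) (2 ^ (n * t))
    have e3 := Nat.mod_lt (morton J (cells q k g y)) (Nat.two_pow_pos (n * t))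
    rw [ht] at e1
    have e4 : morton J (cells q k g y) < morton J (cells q k g x) + 2 ^ (n * t) := by omega
    have e5 : key y < key x + 2 ^ (n * t) := by
      have := Int.ofNat_lt.2 e4
      push_cast at this
      exact this
    rw [pow_succ, hpow]
    linarith
  have hblocks : ∀ s ∈ Finset.range J, (Z.image (· / 2 ^ (n * s))).card ≤
      2 ^ n * coveringNum (g * 2 ^ s / 2) K := by
    intro s hs
    obtain ⟨B, hB, hBK⟩ := exists_blocks hK hq k hg s
    refine le_trans ?_ hB
    refine (Finset.card_le_card (t := B.image fun c => ((morton (J - s) c : ℕ) : ℤ)) ?_).trans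
      Finset.card_image_le
    intro z hz
    obtain ⟨z, hzZ, rfl⟩ := Finset.mem_image.1 hz
    obtain ⟨x, hxK, hx, rfl⟩ := (hZ z).1 hzZ
    refine Finset.mem_image.2 ⟨_, hBK x hxK, ?_⟩
    simp only [hdiv]
    rw [← morton_div, Nat.sub_add_cancel (Finset.mem_range.1 hs).le]
  have hcost : Tape.chainCost (fun z z' => n * lev z z' + 2 + 1) Z.sort ≤ S * S := by
    refine (chainCost_le (b := fun s => 2 ^ (n * s)) (fun s => by positivity) J n Z.sort
      Z.sortedLT_sort.pairwise).trans (le_trans ?_ hNS)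
    rw [Finset.length_sort, Finset.sort_toFinset, add_mul, add_comm (n * _)]
    refine add_le_add (Nat.mul_le_mul_left 3 ?_) (Nat.mul_le_mul_left n (Finset.sum_le_sum hblocks))
    have h0 : Z.card ≤ 2 ^ n * coveringNum (g * 2 ^ 0 / 2) K := by
      have := hblocks 0 (Finset.mem_range.2 hJ)
      simpa using this
    exact h0.trans (Finset.single_le_sum
      (f := fun s => 2 ^ n * coveringNum (g * 2 ^ s / 2) K) (fun _ _ => Nat.zero_le _)
      (Finset.mem_range.2 hJ))
  obtain ⟨G, hG, hGv⟩ := exists_nn_memorizing hS v _ _ hfits hcost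
  refine ⟨fun y => ε * G y, hG.postcomp (T := fun y => ε * y) (by fun_prop), fun x hxK hx => ?_⟩
  have h1 := hGv (key x) ((Finset.mem_sort _).2 ((hZ _).2 ⟨x, hxK, hx, rfl⟩))
  have h2 : ((morton J (cells q k g x) : ℕ) : ℝ) = ((key x : ℤ) : ℝ) := by simp [key]
  simp only [h2, h1]
  exact hv _ x hx.1 rfl

end IntrinsicReLU

/-! ### Networks for Hölder functions -/

namespace IntrinsicReLU

theorem numParams_replicate_le {a b W : ℕ} (ha : a ≤ W) (hb : b ≤ W) (L : ℕ) :
    numParams a (List.replicate L W) b ≤ (L + 1) * (W * W + W) := by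
  induction L generalizing a with
  | zero =>
    have := Nat.mul_le_mul hb ha
    simp only [List.replicate_zero, numParams]
    omega
  | succ L ih =>
    have h1 := ih (le_refl W)
    have h2 := Nat.mul_le_mul_left W ha
    rw [List.replicate_succ, numParams, add_one_mul (L + 1)]
    omega

/-- The network: interleaved digits, memorizing networks and the median over all shifts. -/
theorem exists_nn_holder {n J S : ℕ} (hn : 1 ≤ n) (hJ : 1 ≤ J) (hS : 0 < S)
    {α ε g : ℝ} (hα : 0 < α) (hα1 : α ≤ 1) (hε : 0 < ε) (hg : 0 < g)
    (hgε : n * ((2 * n + 1) * g) = ε ^ (1 / α)) (hgJ : 1 / g ≤ 2 ^ J)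
    {f : (Fin n → ℝ) → ℝ} (hf : holderSeminorm α f ≤ 1) {K : Set (Fin n → ℝ)} (hK : K ⊆ cube n)
    (hNS : (n + 3) * ∑ s ∈ Finset.range J, 2 ^ n * coveringNum (g * 2 ^ s / 2) K ≤ S * S) :
    ∃ (L : ℕ) (F : (Fin n → ℝ) → ℝ), L ≤ J + 12 * S + (2 * n + 1) ^ 2 ∧
      NN (List.replicate L ((2 * n + 1) * (4 * n + 12))) F ∧ ∀ x ∈ K, |f x - F x| ≤ ε := by
  obtain ⟨T, -, hbox⟩ := exists_boxes hg hK
  obtain ⟨η, hη, hηT⟩ := exists_pos_forall_le (T ×ˢ (Finset.univ : Finset (Fin n)))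
    (fun bi => 1 - Int.fract (bi.1 bi.2)) (fun bi _ => sub_pos.2 (Int.fract_lt_one _))
  have hJk : ∀ k : Fin (2 * n + 1), 1 / g + (k : ℕ) < (2 * n + 1 : ℕ) * 2 ^ J := by
    intro k
    have h1 : ((k : ℕ) : ℝ) ≤ 2 * n := by exact_mod_cast Nat.lt_succ_iff.1 k.2
    have h2 : (2 : ℝ) ≤ 2 ^ J := le_self_pow₀ one_le_two (by omega)
    have h3 : (1 : ℝ) ≤ n := by exact_mod_cast hn
    push_cast
    nlinarith
  choose H hH hHf using fun k : Fin (2 * n + 1) => exists_holder_channel hn (by omega) hJ hS hα hα1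
    hε hg (by push_cast; exact hgε) hf hK T (hJk k) hNS
  obtain ⟨M, F, hM, hF, hmed⟩ := exists_nn_median n (w := (2 * n + 1) * (4 * n + 12)) (by nlinarith)
  have h1 : ∀ k : Fin (2 * n + 1), NN (List.replicate (J + 12 * S) (4 * n + 12))
      (fun x : Fin n → ℝ => H k (bitRun η (2 * n + 1) J
        (Sum.elim (fun i => x i / g + (k : ℕ)) fun _ => 0) (.inr ()))) := by
    intro k
    have e1 : NN (List.replicate J (4 * n + 12)) fun x : Fin n → ℝ => bitRun η (2 * n + 1) J
        (Sum.elim (fun i => x i / g + (k : ℕ)) fun _ => 0) (.inr ()) :=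
      ((nn_bitRun (by omega) η (2 * n + 1) J).precomp
        (T := fun x : Fin n → ℝ => Sum.elim (fun i => x i / g + (k : ℕ)) fun _ => 0)
        (IsAff.pi fun i => by rcases i with i | i <;> simp <;> fun_prop)).postcomp
        (T := fun s => s (.inr ())) (by fun_prop)
    exact (NN.mono (by omega) (hH k)).comp_replicate e1
  refine ⟨J + 12 * S + M, _, by omega,
    hF.comp_replicate ((NN.pi h1).precomp (T := fun x _ => x) (by fun_prop)), fun x hx => ?_⟩
  obtain ⟨b, hb, hxb⟩ := hbox x hx
  refine abs_sub_le_of_median hmed _ (card_not_avoids_le (2 * n + 1) b) fun k hk => ?_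
  simp only [Finset.mem_filter, Finset.mem_univ, true_and, not_not] at hk
  have h2 := hHf k x hx ⟨hK hx, b, hb, hxb, hk⟩
  have h3 := bitRun_eq hk (fun i => (hxb i).1) (fun i => (hxb i).2)
    (fun i => div_nonneg ((hK hx).1 i) hg.le) hη
    (fun i => hηT (b, i) (Finset.mem_product.2 ⟨hb, Finset.mem_univ i⟩)) (by omega) J 0
  have h4 : ∀ i, cell (2 * n + 1) k (x i / g) / 2 ^ J = 0 := by
    intro i
    refine Nat.div_eq_of_lt ((Nat.floor_lt' (Nat.two_pow_pos J).ne').2 ?_)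
    rw [div_lt_iff₀ (by positivity)]
    have : x i / g ≤ 1 / g := div_le_div_of_nonneg_right ((hK hx).2 i) hg.le
    have := hJk k
    push_cast at this ⊢
    linarith
  simp only [h4, mul_zero, Nat.cast_zero, sub_zero, zero_add] at h3
  rw [h3]
  exact h2

/-- The sum over all scales is dominated by the finest one. -/
theorem sum_rpow_scales_le {e g : ℝ} (he : 0 < e) (hg : 0 < g) (J : ℕ) :
    ∑ s ∈ Finset.range J, (g * 2 ^ s / 2) ^ (-e) ≤ (g / 2) ^ (-e) * (1 - 2 ^ (-e))⁻¹ := by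
  have h0 : (0 : ℝ) ≤ 2 ^ (-e) := by positivity
  have h1 : (2 : ℝ) ^ (-e) < 1 := Real.rpow_lt_one_of_one_lt_of_neg one_lt_two (by linarith)
  calc ∑ s ∈ Finset.range J, (g * 2 ^ s / 2) ^ (-e)
      = (g / 2) ^ (-e) * ∑ s ∈ Finset.range J, ((2 : ℝ) ^ (-e)) ^ s := by
        rw [Finset.mul_sum]
        refine Finset.sum_congr rfl fun s _ => ?_
        rw [mul_div_right_comm, Real.mul_rpow (by positivity) (by positivity), ← Real.rpow_natCast,
          ← Real.rpow_natCast, ← Real.rpow_mul (by norm_num), ← Real.rpow_mul (by norm_num),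
          mul_comm (s : ℝ)]
    _ ≤ _ := by
        refine mul_le_mul_of_nonneg_left ?_ (by positivity)
        rw [← tsum_geometric_of_lt_one h0 h1]
        exact (summable_geometric_of_lt_one h0 h1).sum_le_tsum _ fun _ _ => by positivity

/-- With `Y = (g / 2) ^ (-d / 2)`, which is a multiple of `(1 / ε) ^ (d / (2 * α))`, the
keys need at most `A Y ^ 2` digits in all, and there are at most `B Y` levels, since every level
contributes at least `1` to the series with exponent `d / 2`. -/
theorem exists_reLUNet_of_pos {n : ℕ} (hn : 1 ≤ n) (C₁ : ℝ) {d : ℝ} (hd : 0 < d) :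
    ∃ C₂ : ℝ, ∀ K : Set (Fin n → ℝ), K ⊆ cube n →
      (∀ δ : ℝ, 0 < δ → δ ≤ 1 → (coveringNum δ K : ℝ) ≤ C₁ * δ ^ (-d)) →
      ∀ α : ℝ, 0 < α → α ≤ 1 → ∀ f : (Fin n → ℝ) → ℝ, holderSeminorm α f ≤ 1 →
      ∀ ε : ℝ, 0 < ε → ε ≤ 1 →
      ∃ (ws : List ℕ) (ψ : ReLUNet n ws 1),
        (numParams n ws 1 : ℝ) ≤ C₂ * (1 / ε) ^ (d / (2 * α)) ∧
        ∀ x ∈ K, |f x - ψ.eval x 0| ≤ ε := by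
  set W : ℕ := (2 * n + 1) * (4 * n + 12) with hW
  set A : ℝ := (n + 3) * 2 ^ n * C₁ * (1 - 2 ^ (-d))⁻¹ with hA
  set B : ℝ := (1 - 2 ^ (-(d / 2)))⁻¹ with hB
  set b : ℝ := 2 * (n * (2 * n + 1)) with hb
  refine ⟨((B + 12 * √A) * b ^ (d / 2) + (25 + (2 * n + 1) ^ 2)) * (W * W + W),
    fun K hK hcov α hα hα1 f hf ε hε hε1 => ?_⟩
  have hn' : (1 : ℝ) ≤ n := by exact_mod_cast hn
  have hC₁ : 0 ≤ C₁ := by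
    have := hcov 1 one_pos le_rfl
    rw [Real.one_rpow, mul_one] at this
    exact (Nat.cast_nonneg _).trans this
  have hq : ∀ e : ℝ, 0 < e → 0 < 1 - (2 : ℝ) ^ (-e) := fun e he =>
    sub_pos.2 (Real.rpow_lt_one_of_one_lt_of_neg one_lt_two (by linarith))
  have hA0 : 0 ≤ A := by
    have := hq d hd
    positivity
  have hB0 : 0 ≤ B := (inv_pos.2 (hq _ (half_pos hd))).le
  have hb0 : 0 < b := by positivity
  set g : ℝ := ε ^ (1 / α) / (n * (2 * n + 1)) with hg
  have hε0 : 0 < ε ^ (1 / α) := Real.rpow_pos_of_pos hε _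
  have hg0 : 0 < g := by positivity
  have hgε : n * ((2 * n + 1) * g) = ε ^ (1 / α) := by rw [hg]; field_simp
  have hg1 : 3 ≤ 1 / g := by
    rw [hg, one_div_div, le_div_iff₀ hε0]
    have : ε ^ (1 / α) ≤ 1 := Real.rpow_le_one hε.le hε1 (by positivity)
    nlinarith
  set X : ℝ := (1 / ε) ^ (d / (2 * α)) with hX
  have hX1 : 1 ≤ X := Real.one_le_rpow ((one_le_div hε).2 hε1) (by positivity)
  set Y : ℝ := (g / 2) ^ (-(d / 2)) with hY
  have hYX : Y = b ^ (d / 2) * X := by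
    have e1 : g / 2 = ε ^ (1 / α) / b := by
      rw [hg, hb, div_div, mul_comm (2 : ℝ) (n * (2 * n + 1))]
    rw [hY, e1, Real.rpow_neg (by positivity), ← Real.inv_rpow (by positivity), inv_div, hX,
      Real.div_rpow hb0.le hε0.le, ← Real.rpow_mul hε.le, one_div ε, Real.inv_rpow hε.le,
      div_eq_mul_inv]
    congr 3
    field_simp
  have hY0 : 0 < Y := by positivity
  have hYY : (g / 2) ^ (-d) = Y * Y := by
    rw [hY, ← Real.rpow_add (by positivity)]
    congr 1
    ring
  set J := Nat.clog 2 ⌈1 / g⌉₊ with hJ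
  have hceil : 2 ≤ ⌈1 / g⌉₊ := by
    have : (3 : ℝ) ≤ ⌈1 / g⌉₊ := hg1.trans (Nat.le_ceil _)
    have : 3 ≤ ⌈1 / g⌉₊ := by exact_mod_cast this
    omega
  have hJ1 : 1 ≤ J := Nat.clog_pos one_lt_two hceil
  have hgJ : 1 / g ≤ 2 ^ J := by
    refine (Nat.le_ceil _).trans ?_
    exact_mod_cast Nat.le_pow_clog one_lt_two _
  have hscale : ∀ s ∈ Finset.range J, g * 2 ^ s / 2 ≤ 1 := by
    intro s hs
    have e1 : 2 ^ s < ⌈1 / g⌉₊ :=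
      (Nat.pow_le_pow_right two_pos (by have := Finset.mem_range.1 hs; omega : s ≤ J - 1)).trans_lt
        (Nat.pow_pred_clog_lt_self one_lt_two hceil)
    have e2 := Nat.lt_ceil.1 e1
    rw [lt_div_iff₀ hg0] at e2
    push_cast at e2
    linarith
  have hJY : (J : ℝ) ≤ B * Y := by
    refine le_trans ?_ ((sum_rpow_scales_le (half_pos hd) hg0 J).trans_eq (mul_comm _ _))
    calc (J : ℝ) = ∑ s ∈ Finset.range J, (1 : ℝ) := by simp
      _ ≤ _ := Finset.sum_le_sum fun s hs => Real.one_le_rpow_of_pos_of_le_one_of_nonpos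
          (by positivity) (hscale s hs) (by linarith)
  -- the square root of the total number of digits; the summand `1` makes `S` positive
  set S := ⌈√A * Y⌉₊ + 1 with hS
  have hS1 : √A * Y ≤ S := (Nat.le_ceil _).trans (by rw [hS]; push_cast; linarith)
  have hS2 : (S : ℝ) ≤ √A * Y + 2 := by
    have := Nat.ceil_lt_add_one (show 0 ≤ √A * Y by positivity)
    rw [hS]; push_cast; linarith
  have hNS : (n + 3) * ∑ s ∈ Finset.range J, 2 ^ n * coveringNum (g * 2 ^ s / 2) K ≤ S * S := by
    have e1 : (((n + 3) * ∑ s ∈ Finset.range J, 2 ^ n * coveringNum (g * 2 ^ s / 2) K : ℕ) : ℝ) ≤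
        (S * S : ℕ) := by
      push_cast
      calc ((n : ℝ) + 3) * ∑ s ∈ Finset.range J, 2 ^ n * (coveringNum (g * 2 ^ s / 2) K : ℝ)
          ≤ (n + 3) * ∑ s ∈ Finset.range J, 2 ^ n * (C₁ * (g * 2 ^ s / 2) ^ (-d)) := by
            gcongr with s hs
            exact hcov _ (by positivity) (hscale s hs)
        _ = (n + 3) * 2 ^ n * C₁ * ∑ s ∈ Finset.range J, (g * 2 ^ s / 2) ^ (-d) := by
            simp only [Finset.mul_sum]
            exact Finset.sum_congr rfl fun s _ => by ring
        _ ≤ (n + 3) * 2 ^ n * C₁ * ((g / 2) ^ (-d) * (1 - 2 ^ (-d))⁻¹) := by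
            gcongr
            exact sum_rpow_scales_le hd hg0 J
        _ = A * (Y * Y) := by rw [hYY, hA]; ring
        _ = (√A * Y) * (√A * Y) := by
            rw [mul_mul_mul_comm √A, Real.mul_self_sqrt hA0]
        _ ≤ S * S := by gcongr
    exact_mod_cast e1
  obtain ⟨L, F, hL, hF, hFf⟩ := exists_nn_holder hn hJ1 (Nat.succ_pos _ : 0 < S) hα hα1 hε hg0 hgε
    hgJ hf hK hNS
  obtain ⟨ψ, hψ⟩ := (hF.postcomp (T := fun y (_ : Fin 1) => y) (by fun_prop)).exists_reLUNet
  refine ⟨_, ψ, ?_, fun x hx => by rw [hψ]; exact hFf x hx⟩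
  have h1 := numParams_replicate_le (a := n) (b := 1) (W := W) (by nlinarith) (by nlinarith) L
  have h2 : (L : ℝ) + 1 ≤ J + 12 * S + (2 * n + 1) ^ 2 + 1 := by
    have : L + 1 ≤ J + 12 * S + (2 * n + 1) ^ 2 + 1 := by omega
    exact_mod_cast this
  calc (numParams n (List.replicate L W) 1 : ℝ) ≤ (L + 1) * (W * W + W) := by exact_mod_cast h1
    _ ≤ (((B + 12 * √A) * b ^ (d / 2) + (25 + (2 * n + 1) ^ 2)) * X) * (W * W + W) := by
      refine mul_le_mul_of_nonneg_right ?_ (by positivity)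
      have h3 : (25 + (2 * (n : ℝ) + 1) ^ 2) * 1 ≤ (25 + (2 * n + 1) ^ 2) * X := by gcongr
      calc (L : ℝ) + 1 ≤ (B + 12 * √A) * Y + (25 + (2 * n + 1) ^ 2) := by linarith
        _ ≤ _ := by rw [hYX]; linarith
    _ = _ := by ring

/-! ### Functions on finite sets -/

/-- A set whose covering numbers stay bounded is finite. -/
theorem finite_of_coveringNum_le {n M : ℕ} {K : Set (Fin n → ℝ)} (hK : K ⊆ cube n)
    (h : ∀ δ : ℝ, 0 < δ → δ ≤ 1 → coveringNum δ K ≤ M) :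
    ∃ T : Finset (Fin n → ℝ), T.card ≤ M ∧ K = T := by
  classical
  have key : ∀ F : Finset (Fin n → ℝ), ↑F ⊆ K → F.card ≤ M := by
    intro F hF
    obtain ⟨η, hη, hηF⟩ := exists_pos_forall_le F.offDiag (fun xy => dist xy.1 xy.2)
      fun xy h => dist_pos.2 (Finset.mem_offDiag.1 h).2.2
    have hδ : 0 < min 1 (η / 3) := by positivity
    obtain ⟨t, ht, hcov⟩ := exists_cover hδ hK
    refine le_trans ?_ (ht.trans (h _ hδ (min_le_left _ _)))
    choose! c hc hxc using hcov
    refine Finset.card_le_card_of_injOn c (fun x hx => hc x (hF hx)) fun x hx y hy hxy => ?_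
    by_contra hne
    have h1 := hηF (x, y) (Finset.mem_offDiag.2 ⟨hx, hy, hne⟩)
    have h2 : dist x y ≤ 2 * (η / 3) := by
      refine (dist_pi_le_iff (by positivity)).2 fun i => ?_
      have e1 := abs_le.1 ((hxc x (hF hx) i).trans (min_le_right _ _))
      have e2 := abs_le.1 ((hxc y (hF hy) i).trans (min_le_right _ _))
      rw [← hxy] at e2
      rw [Real.dist_eq, abs_le]
      constructor <;> linarith
    simp only at h1
    linarith
  have hfin : K.Finite := by
    by_contra hinf
    obtain ⟨F, hF, hcard⟩ := Set.Infinite.exists_subset_card_eq hinf (M + 1)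
    have := key F hF
    omega
  exact ⟨hfin.toFinset, key _ (by simp), by simp⟩

/-- The `ℓ₁` distance, as a sum of ReLUs. -/
noncomputable def reluDist {n : ℕ} (x c : Fin n → ℝ) : ℝ :=
  ∑ i, (relu (x i - c i) + relu (c i - x i))

theorem neg_reluDist_nonneg_iff {n : ℕ} (x c : Fin n → ℝ) : 0 ≤ -reluDist x c ↔ x = c := by
  have e : reluDist x c = ∑ i, |x i - c i| := by
    refine Finset.sum_congr rfl fun i _ => ?_
    rw [← neg_sub (x i), relu, relu, ← posPart_def, ← negPart_def, posPart_add_negPart]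
  rw [e, neg_nonneg]
  constructor
  · intro h
    have h0 := (Finset.sum_eq_zero_iff_of_nonneg fun i _ => abs_nonneg _).1
      (le_antisymm h (Finset.sum_nonneg fun i _ => abs_nonneg _))
    exact funext fun i => sub_eq_zero.1 (abs_eq_zero.1 (h0 i (Finset.mem_univ i)))
  · rintro rfl; simp

/-- Two hidden layers: the first one computes the distances to the points `c j`, the second one
tests them. -/
theorem nn_sum_thresholds {n M : ℕ} {ι : Type} [Fintype ι] (hM : Fintype.card ι ≤ M)
    (c : ι → Fin n → ℝ) (a v : ι → ℝ) :
    NN [2 * n * M, 2 * M] fun x : Fin n → ℝ =>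
      ∑ j, v j * (relu (a j * -reluDist x (c j) + 1) - relu (a j * -reluDist x (c j))) := by
  have h2 := NN.layer (κ := ι ⊕ ι) (w := 2 * M) (by rw [Fintype.card_sum]; omega)
    (T := fun z : (ι × Fin n) ⊕ (ι × Fin n) → ℝ =>
      Sum.elim (fun j => a j * -∑ i, (z (.inl (j, i)) + z (.inr (j, i))) + 1)
        (fun j => a j * -∑ i, (z (.inl (j, i)) + z (.inr (j, i)))))
    (IsAff.pi fun j => by
      rcases j with j | j <;> simp only [Sum.elim_inl, Sum.elim_inr] <;> fun_prop)
    (A := fun y => ∑ j, v j * (y (.inl j) - y (.inr j))) (by fun_prop)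
  have hcard : Fintype.card ((ι × Fin n) ⊕ (ι × Fin n)) ≤ 2 * n * M := by
    rw [Fintype.card_sum, Fintype.card_prod, Fintype.card_fin]
    nlinarith
  have h1 := NN.hidden hcard
    (T := fun x : Fin n → ℝ => Sum.elim (fun p => x p.2 - c p.1 p.2) (fun p => c p.1 p.2 - x p.2))
    (IsAff.pi fun j => by
      rcases j with j | j <;> simp only [Sum.elim_inl, Sum.elim_inr] <;> fun_prop) h2
  exact h1.congr fun x => rfl

theorem exists_nn_interpolating {n M : ℕ} (T : Finset (Fin n → ℝ)) (hT : T.card ≤ M)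
    (f : (Fin n → ℝ) → ℝ) :
    ∃ F : (Fin n → ℝ) → ℝ, NN [2 * n * M, 2 * M] F ∧ ∀ x ∈ T, F x = f x := by
  classical
  choose a ha using fun c : T => exists_threshold T.finite_toSet (fun x => -reluDist x c.1)
  refine ⟨_, nn_sum_thresholds (by simpa using hT) (fun c : T => c.1) a (fun c => f c.1),
    fun x hx => ?_⟩
  simp only [ha _ x hx, neg_reluDist_nonneg_iff]
  rw [Finset.sum_eq_single ⟨x, hx⟩]
  · simp
  · intro c _ hc
    rw [if_neg fun h => hc (Subtype.ext h.symm), mul_zero]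
  · simp

/-- The widths depend on the bound for the number of points only. -/
theorem exists_reLUNet_of_zero (n : ℕ) (C₁ : ℝ) :
    ∃ C₂ : ℝ, ∀ K : Set (Fin n → ℝ), K ⊆ cube n →
      (∀ δ : ℝ, 0 < δ → δ ≤ 1 → (coveringNum δ K : ℝ) ≤ C₁) → ∀ f : (Fin n → ℝ) → ℝ,
      ∃ (ws : List ℕ) (ψ : ReLUNet n ws 1),
        (numParams n ws 1 : ℝ) ≤ C₂ ∧ ∀ x ∈ K, ψ.eval x 0 = f x := by
  refine ⟨numParams n [2 * n * ⌊C₁⌋₊, 2 * ⌊C₁⌋₊] 1, fun K hK hcov f => ?_⟩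
  obtain ⟨T, hT, rfl⟩ := finite_of_coveringNum_le hK fun δ h1 h2 => Nat.le_floor (hcov δ h1 h2)
  obtain ⟨F, hF, hFf⟩ := exists_nn_interpolating T hT f
  obtain ⟨ψ, hψ⟩ := (hF.postcomp (T := fun y (_ : Fin 1) => y) (by fun_prop)).exists_reLUNet
  exact ⟨_, ψ, le_rfl, fun x hx => by rw [hψ]; exact hFf x hx⟩

end IntrinsicReLU

theorem mainTheorem3 :
    (∃ C : ℕ, ∀ (n m : ℕ), 1 ≤ n → 1 ≤ m →
      ∀ (f : (Fin n → ℝ) → ℝ) (K : Set (Fin n → ℝ)), K ⊆ cube n →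
      ∃ (L : ℕ)
        (Φ : ReLUNet 1 (List.replicate 3 (2 * (2 * n + 1) * (m + 1)) ++ [m + 1]) (2 * n + 1))
        (ρ : ReLUNet (n * (2 * n + 1))
          (List.replicate (C * (m + 1)) (C * (n + 1)) ++ List.replicate L (12 * (2 * n + 1))) 1),
        (L : ℝ) ≤ C * max
            (Real.sqrt ((coveringNum (1 / (2 * (m : ℝ) * (2 * (n : ℝ) + 1))) K : ℝ) *
              Real.log ((n : ℝ) * (2 * (m : ℝ) + 1) *
                (coveringNum (1 / (2 * (m : ℝ) * (2 * (n : ℝ) + 1))) K : ℝ))))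
            (Real.log (2 * (n : ℝ) + 1) ^ 2) ∧
        ∀ x ∈ K, ENNReal.ofReal |f x - ρ.eval (stack Φ x) 0| ≤ 2 * modulus f (1 / (2 * (m : ℝ)))) ∧
    (∀ (n : ℕ) (C₁ dint : ℝ), 1 ≤ n → 0 ≤ dint →
      ∃ C₂ : ℝ, ∀ K : Set (Fin n → ℝ), K ⊆ cube n →
        (∀ δ : ℝ, 0 < δ → δ ≤ 1 → (coveringNum δ K : ℝ) ≤ C₁ * δ ^ (-dint)) →
        ∀ α : ℝ, 0 < α → α ≤ 1 → ∀ f : (Fin n → ℝ) → ℝ, holderSeminorm α f ≤ 1 →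
        ∀ ε : ℝ, 0 < ε → ε ≤ 1 →
        ∃ (ws : List ℕ) (ψ : ReLUNet n ws 1),
          (numParams n ws 1 : ℝ) ≤ C₂ * (1 / ε) ^ (dint / (2 * α)) ∧
          ∀ x ∈ K, |f x - ψ.eval x 0| ≤ ε) := by
  refine ⟨⟨3000, fun n m hn hm f K hK => ?_⟩, fun n C₁ d hn hd => ?_⟩
  · obtain ⟨L, Φ, ρ, hL, h⟩ := exists_networks hn hm f hK
    refine ⟨L, Φ, ρ, ?_, h⟩
    exact_mod_cast hL.trans (mul_le_mul_of_nonneg_left (le_max_left _ _) (by norm_num))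
  · rcases hd.eq_or_lt with rfl | hd
    · obtain ⟨C₂, h⟩ := exists_reLUNet_of_zero n C₁
      refine ⟨C₂, fun K hK hcov α _ _ f _ ε hε _ => ?_⟩
      obtain ⟨ws, ψ, hψ, hf⟩ := h K hK
        (fun δ h1 h2 => by simpa using hcov δ h1 h2) f
      exact ⟨ws, ψ, by simpa using hψ, fun x hx => by rw [hf x hx, sub_self, abs_zero]; exact hε.le⟩
    · exact exists_reLUNet_of_pos hn C₁ hd
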